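/- Let $n\ge 3$, let $\Omega\subset\mathbb R^n$ be a bounded open set, $T>0$, $Q^T=\Omega\times(0,T)$, let $C_0>0$, $\lambda\ge 0$ and $\alpha,\beta\ge 0$ with $\alpha>0$ or $\beta>0$ (so that the three cases $\alpha,\beta>0$; $\alpha=0<\beta$; $\beta=0<\alpha$ are covered), and let $\omega_n$ be the surface area of the unit sphere of $\mathbb R^n$. Let $f,g\in L^2(Q^T)=L^2(0,T;L^2(\Omega))$. Consider the limit system $$ (28)\quad\begin{cases} \alpha\,\partial_t u-\Delta u+(n-2)C_0^{n-2}\omega_n H=f & \text{in } Q^T,\\ \beta\,\partial_t H+\frac{n-2}{C_0}H=\lambda(u-H)+\beta\,\partial_t u-g & \text{in } Q^T,\\ u=0 & \text{on } \partial\Omega\times(0,T),\\ \alpha u(x,0)=0,\quad \beta H(x,0)=0 & \text{in }\Omega, \end{cases} $$ and the system obtained from it by the change of variable $v=u-H$, $$ (28b)\quad\begin{cases} \alpha\,\partial_t u-\Delta u+(n-2)C_0^{n-2}\omega_n (u-v)=f & \text{in } Q^T,\\ \beta\,\partial_t v+\left(\frac{n-2}{C_0}+\lambda\right)v=\frac{n-2}{C_0}u+g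 & \text{in } Q^T,\\ u=0 & \text{on } \partial\Omega\times(0,T),\\ \alpha u(x,0)=0,\quad \beta v(x,0)=0 & \text{in }\Omega. \end{cases} $$ A weak solution of (28) is a pair $u\in L^2(0,T;H^1_0(\Omega))$, $H\in L^2(Q^T)$ such that: * $\alpha u\in C([0,T];L^2(\Omega))$ with $\alpha u(0)=0$, $\alpha\,\partial_t u\in L^2(0,T;H^{-1}(\Omega))$, and for every $\varphi\in L^2(0,T;H^1_0(\Omega))$ $$\int_0^T\langle \alpha\,\partial_t u,\varphi\rangle\,dt+\int_{Q^T}\nabla u\cdot\nabla\varphi\,dx\,dt+(n-2)C_0^{n-2}\omega_n\int_{Q^T}H\varphi\,dx\,dt=\int_{Q^T}f\varphi\,dx\,dt;$$ * $\beta H\in C([0,T];L^2(\Omega))$ with $\beta H(0)=0$, $\partial_t\big(\beta(H-u)\big)\in L^2(0,T;L^2(\Omega))$, and $\partial_t\big(\beta(H-u)\big)+\frac{n-2}{C_0}H=\lambda(u-H)-g$ a.e. in $Q^T$. A weak solution of (28b) is a pair $u\in L^2(0,T;H^1_0(\Omega))$, $v\in L^2(Q^T)$ such that $u$ satisfies the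 first item with $H$ replaced by $u-v$, and $\beta v\in C([0,T];L^2(\Omega))$ with $\beta v(0)=0$, $\beta\,\partial_t v\in L^2(0,T;L^2(\Omega))$, and the second equation of (28b) holds a.e. in $Q^T$. Time derivatives are taken in the sense of distributions on $(0,T)$, and continuity in time is meant for a representative. Then: 1. (Comparison principle) If $f\le 0$ and $g\le 0$ a.e. in $Q^T$ and $(u,v)$ is a weak solution of (28b), then $u\le 0$ and $v\le 0$ a.e. in $Q^T$. 2. (Uniqueness) For given $f,g$, the system (28b) has at most one weak solution $(u,v)$, and the system (28) has at most one weak solution $(u,H)$. -/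

import Mathlib

open MeasureTheory Set
open scoped ContDiff

noncomputable section

namespace LimitSystem

variable {n : ℕ}

/-- `L²(Ω)`. -/
abbrev L2 (Ω : Set (EuclideanSpace ℝ (Fin n))) : Type :=
  Lp ℝ 2 (volume.restrict Ω)

/-- `L²(Ω)ⁿ`, the square integrable vector fields on `Ω`. -/
abbrev L2Vec (Ω : Set (EuclideanSpace ℝ (Fin n))) : Type :=
  Lp (EuclideanSpace ℝ (Fin n)) 2 (volume.restrict Ω)

/-- The pairs `(φ, ∇φ)` with `φ ∈ C_c^∞(Ω)`, as elements of `L²(Ω) × L²(Ω)ⁿ`. -/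
def testPairs (Ω : Set (EuclideanSpace ℝ (Fin n))) : Set (WithLp 2 (L2 Ω × L2Vec Ω)) :=
  {p | ∃ φ : EuclideanSpace ℝ (Fin n) → ℝ,
    ContDiff ℝ ∞ φ ∧ HasCompactSupport φ ∧ tsupport φ ⊆ Ω ∧
    (∀ᵐ x ∂volume.restrict Ω, p.fst x = φ x) ∧
    (∀ᵐ x ∂volume.restrict Ω, p.snd x = gradient φ x)}

/-- `H¹₀(Ω)`, the closure of `C_c^∞(Ω)` in the norm `(‖w‖² + ‖∇w‖²)^{1/2}`. An element is the pair
`(w, ∇w)` of a function and its weak gradient. -/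
def H10 (Ω : Set (EuclideanSpace ℝ (Fin n))) : Submodule ℝ (WithLp 2 (L2 Ω × L2Vec Ω)) :=
  (Submodule.span ℝ (testPairs Ω)).topologicalClosure

/-- The inclusion `H¹₀(Ω) → L²(Ω)`. -/
def toL2 {Ω : Set (EuclideanSpace ℝ (Fin n))} : H10 Ω →L[ℝ] L2 Ω :=
  (WithLp.fstL 2 ℝ (L2 Ω) (L2Vec Ω)).comp (H10 Ω).subtypeL

/-- The weak gradient `∇ : H¹₀(Ω) → L²(Ω)ⁿ`. -/
def grad {Ω : Set (EuclideanSpace ℝ (Fin n))} : H10 Ω →L[ℝ] L2Vec Ω :=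
  (WithLp.sndL 2 ℝ (L2 Ω) (L2Vec Ω)).comp (H10 Ω).subtypeL

/-- `H⁻¹(Ω)`, the dual of `H¹₀(Ω)`. -/
abbrev Hneg1 (Ω : Set (EuclideanSpace ℝ (Fin n))) : Type :=
  StrongDual ℝ (H10 Ω)

/-- The embedding `L²(Ω) → H⁻¹(Ω)`, `y ↦ (φ ↦ ∫_Ω y φ)`. -/
def toHneg1 {Ω : Set (EuclideanSpace ℝ (Fin n))} (y : L2 Ω) : Hneg1 Ω :=
  (innerSL ℝ y).comp toL2

/-- Lebesgue measure on the time interval `(0, T)`. -/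
abbrev timeMeasure (T : ℝ) : Measure ℝ := volume.restrict (Ioo 0 T)

/-- `y ∈ L²(0, T; X)`. -/
def IsL2InTime {X : Type*} [NormedAddCommGroup X] (T : ℝ) (y : ℝ → X) : Prop :=
  MemLp y 2 (timeMeasure T)

/-- `∂ₜ y = w` in the sense of `X`-valued distributions on `(0, T)`. -/
def HasWeakTimeDeriv {X : Type*} [NormedAddCommGroup X] [NormedSpace ℝ X]
    (T : ℝ) (y w : ℝ → X) : Prop :=
  ∀ η : ℝ → ℝ, ContDiff ℝ ∞ η → HasCompactSupport η → tsupport η ⊆ Ioo 0 T →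
    ∫ t, deriv η t • y t ∂timeMeasure T = -∫ t, η t • w t ∂timeMeasure T

/-- `y ∈ C([0, T]; X)`, up to a null set of times, and `y(0) = y₀`. -/
def HasInitialValue {X : Type*} [NormedAddCommGroup X]
    (T : ℝ) (y : ℝ → X) (y₀ : X) : Prop :=
  ∃ z : ℝ → X, ContinuousOn z (Icc 0 T) ∧ (∀ᵐ t ∂timeMeasure T, y t = z t) ∧ z 0 = y₀

/-- `ω_n`, the surface area of the unit sphere of `ℝⁿ`. -/
def sphereArea (n : ℕ) : ℝ :=
  (volume : Measure (EuclideanSpace ℝ (Fin n))).toSphere.real univ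

/-- The constant `(n - 2) C₀^{n-2} ω_n`. -/
def strangeCoeff (n : ℕ) (C₀ : ℝ) : ℝ :=
  ((n : ℝ) - 2) * C₀ ^ ((n : ℝ) - 2) * sphereArea n

/-- Weak form of `α ∂ₜu - Δu + (n-2) C₀^{n-2} ω_n H = f` in `Ω × (0, T)`, `u = 0` on
`∂Ω × (0, T)`, `α u(·, 0) = 0`, where `α ∂ₜu ∈ L²(0, T; H⁻¹(Ω))`. -/
structure IsWeakParabolicSolution (Ω : Set (EuclideanSpace ℝ (Fin n))) (T α C₀ : ℝ)
    (f : ℝ → L2 Ω) (u : ℝ → H10 Ω) (H : ℝ → L2 Ω) : Prop where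
  mem_u : IsL2InTime T u
  initial : HasInitialValue T (fun t => α • toL2 (u t)) 0
  equation : ∃ w : ℝ → Hneg1 Ω, IsL2InTime T w ∧
    HasWeakTimeDeriv T (fun t => toHneg1 (α • toL2 (u t))) w ∧
    ∀ φ : ℝ → H10 Ω, IsL2InTime T φ →
      ∫ t, w t (φ t) ∂timeMeasure T
        + ∫ t, inner ℝ (grad (u t)) (grad (φ t)) ∂timeMeasure T
        + strangeCoeff n C₀ * ∫ t, inner ℝ (H t) (toL2 (φ t)) ∂timeMeasure T
      = ∫ t, inner ℝ (f t) (toL2 (φ t)) ∂timeMeasure T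

/-- `(u, H)` is a weak solution of the limit system
`α ∂ₜu - Δu + (n-2) C₀^{n-2} ω_n H = f`,
`β ∂ₜH + ((n-2)/C₀) H = lam (u - H) + β ∂ₜu - g` in `Ω × (0, T)`,
`u = 0` on `∂Ω × (0, T)`, `α u(·, 0) = 0`, `β H(·, 0) = 0`.
The two time derivatives of the second equation are taken together, as
`∂ₜ(β (H - u)) ∈ L²(0, T; L²(Ω))`. -/
structure IsWeakSolution (Ω : Set (EuclideanSpace ℝ (Fin n))) (T α β lam C₀ : ℝ)
    (f g : ℝ → L2 Ω) (u : ℝ → H10 Ω) (H : ℝ → L2 Ω) : Prop where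
  parabolic : IsWeakParabolicSolution Ω T α C₀ f u H
  mem_H : IsL2InTime T H
  initial : HasInitialValue T (fun t => β • H t) 0
  equation : ∃ z : ℝ → L2 Ω, IsL2InTime T z ∧
    HasWeakTimeDeriv T (fun t => β • (H t - toL2 (u t))) z ∧
    ∀ᵐ t ∂timeMeasure T,
      z t + (((n : ℝ) - 2) / C₀) • H t = lam • (toL2 (u t) - H t) - g t

/-- `(u, v)` is a weak solution of the system obtained by the change of variable `v = u - H`,
`α ∂ₜu - Δu + (n-2) C₀^{n-2} ω_n (u - v) = f`,
`β ∂ₜv + ((n-2)/C₀ + lam) v = ((n-2)/C₀) u + g` in `Ω × (0, T)`,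
`u = 0` on `∂Ω × (0, T)`, `α u(·, 0) = 0`, `β v(·, 0) = 0`. -/
structure IsWeakSolutionTransformed (Ω : Set (EuclideanSpace ℝ (Fin n))) (T α β lam C₀ : ℝ)
    (f g : ℝ → L2 Ω) (u : ℝ → H10 Ω) (v : ℝ → L2 Ω) : Prop where
  parabolic : IsWeakParabolicSolution Ω T α C₀ f u (fun t => toL2 (u t) - v t)
  mem_v : IsL2InTime T v
  initial : HasInitialValue T (fun t => β • v t) 0
  equation : ∃ z : ℝ → L2 Ω, IsL2InTime T z ∧
    HasWeakTimeDeriv T (fun t => β • v t) z ∧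
    ∀ᵐ t ∂timeMeasure T,
      z t + (((n : ℝ) - 2) / C₀ + lam) • v t = (((n : ℝ) - 2) / C₀) • toL2 (u t) + g t

end LimitSystem

end

/-!
The proof is an energy argument. Put `κ = (n - 2) C₀^(n-2) ω_n > 0` and `c = (n - 2) / C₀ > 0`, and
let `(u, v)` solve the transformed system with `f, g ≤ 0`. Test the first equation with `u⁺` and the
second with `v⁺`. The time derivatives contribute the nonnegative terms `(α / 2) ‖u⁺(T)‖²` and
`(β / 2) ‖v⁺(T)‖²`, and since `(v, u⁺) ≤ (v⁺, u⁺)` and `(u, v⁺) ≤ (u⁺, v⁺)`,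
`∫ ‖∇u⁺‖² + κ ∫ (‖u⁺‖² - (u⁺, v⁺)) ≤ 0` and `c ∫ (‖v⁺‖² - (u⁺, v⁺)) ≤ 0`.
Together these give `∫ ‖∇u⁺‖² + κ ∫ ‖u⁺ - v⁺‖² ≤ 0`; so `u⁺ = v⁺` and `∇u⁺ = 0`, and the Poincaré
inequality yields `u⁺ = v⁺ = 0`. There is no need for a Gronwall inequality or for
distinguishing whether `α` or `β` vanishes.

Three facts carry this computation.

* `exists_lift_posPart`: `u⁺` is again in `L²(0, T; H¹₀(Ω))`, with `∫ ‖∇u⁺‖² ≤ ∫ ∇u · ∇u⁺`. It is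
  obtained as a weak limit of smooth truncations of functions that are simple in time and test
  functions in space; weak compactness replaces both the chain rule in `H¹₀` and the measurability
  of the truncation in time.
* `integral_apply_posPart_nonneg`: the pairing of `∂ₜ(a y)` with `y⁺` has a nonnegative integral if
  `a y(0) = 0`. The derivative is replaced by backward difference quotients; for these the claim is
  the convexity of `½ ‖·⁺‖²`, and translations are continuous in `L²`. This uses that a function
  with an integrable weak derivative is a primitive of it (`HasWeakTimeDeriv.ae_eq_primitive`).
* `exists_norm_toL2_le`: the Poincaré inequality.

Uniqueness for the transformed system follows by linearity; that `u` vanishes as an element of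
`H¹₀(Ω)`, not only in `L²(Ω)`, is read off from the equation, which reduces to `∫ ‖∇u‖² = 0`. For the
original system the change of variable `v = u - H` is applied to the difference of two solutions.
Its initial condition is the delicate point when `α = 0`, since then no continuity of `u` is assumed:
see `IsWeakSolution.hasInitialValue_sub`.
-/

noncomputable section

namespace LimitSystem

open Filter Topology

/-! ### Weak derivatives in time -/

section Time

lemma IsL2InTime.integrable {X : Type*} [NormedAddCommGroup X] {T : ℝ} {y : ℝ → X}
    (hy : IsL2InTime T y) :
    Integrable y (timeMeasure T) :=
  MemLp.integrable one_le_two hy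

variable {X : Type*} [NormedAddCommGroup X] [NormedSpace ℝ X] {T : ℝ}

lemma integrable_smul_of_contDiff {y : ℝ → X} (hy : Integrable y (timeMeasure T))
    {η : ℝ → ℝ} (hη : Continuous η) (hc : HasCompactSupport η) :
    Integrable (fun t => η t • y t) (timeMeasure T) := by
  obtain ⟨C, hC⟩ := hη.bounded_above_of_compact_support hc
  exact hy.bdd_smul C hη.aestronglyMeasurable (ae_of_all _ hC)

lemma HasWeakTimeDeriv.sub {y₁ y₂ w₁ w₂ : ℝ → X}
    (hy₁ : Integrable y₁ (timeMeasure T)) (hy₂ : Integrable y₂ (timeMeasure T))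
    (hw₁ : Integrable w₁ (timeMeasure T)) (hw₂ : Integrable w₂ (timeMeasure T))
    (h₁ : HasWeakTimeDeriv T y₁ w₁) (h₂ : HasWeakTimeDeriv T y₂ w₂) :
    HasWeakTimeDeriv T (fun t => y₁ t - y₂ t) (fun t => w₁ t - w₂ t) := by
  intro η hη hc hs
  have hη' : Continuous (deriv η) := hη.continuous_deriv (by simp)
  simp only [smul_sub]
  rw [integral_sub (integrable_smul_of_contDiff hy₁ hη' hc.deriv)
      (integrable_smul_of_contDiff hy₂ hη' hc.deriv),
    integral_sub (integrable_smul_of_contDiff hw₁ hη.continuous hc)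
      (integrable_smul_of_contDiff hw₂ hη.continuous hc), h₁ η hη hc hs, h₂ η hη hc hs]
  abel

lemma eq_zero_of_tsupport_subset_Ioo {η : ℝ → ℝ} (hs : tsupport η ⊆ Ioo 0 T) {t : ℝ}
    (ht : t ∉ Ioo 0 T) : η t = 0 := by
  by_contra h
  exact ht (hs (subset_tsupport η h))

lemma continuousOn_primitive_timeMeasure {w : ℝ → X} (hT : 0 < T)
    (hw : Integrable w (timeMeasure T)) :
    ContinuousOn (fun t => ∫ s in (0 : ℝ)..t, w s) (Icc 0 T) := by
  have h : IntegrableOn w (uIcc 0 T) := by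
    rw [uIcc_of_le hT.le, integrableOn_Icc_iff_integrableOn_Ioo]
    exact hw
  simpa [uIcc_of_le hT.le] using intervalIntegral.continuousOn_primitive_interval h

variable [CompleteSpace X]

/-- The primitive of an integrable function has that function as its weak derivative. -/
lemma hasWeakTimeDeriv_primitive {w : ℝ → X} (hw : Integrable w (timeMeasure T)) :
    HasWeakTimeDeriv T (fun t => ∫ s in (0 : ℝ)..t, w s) w := by
  intro η hη hc hs
  have hη' : Continuous (deriv η) := hη.continuous_deriv (by simp)
  have hηi : Integrable (deriv η) (timeMeasure T) :=
    (hη'.integrable_of_hasCompactSupport hc.deriv).mono_measure Measure.restrict_le_self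
  have hint : Integrable
      (Function.uncurry fun t s : ℝ => {p : ℝ × ℝ | p.2 < p.1}.indicator
        (fun p => deriv η p.1 • w p.2) (t, s)) ((timeMeasure T).prod (timeMeasure T)) :=
    (hηi.smul_prod hw).indicator (measurableSet_lt measurable_snd measurable_fst)
  have hswap := integral_integral_swap hint
  have hL : ∀ t ∈ Ioo (0 : ℝ) T, ∫ s in Ioo 0 T, {p : ℝ × ℝ | p.2 < p.1}.indicator
      (fun p => deriv η p.1 • w p.2) (t, s) = deriv η t • ∫ s in (0 : ℝ)..t, w s := by
    intro t ht
    rw [intervalIntegral.integral_of_le ht.1.le, ← integral_smul, integral_Ioc_eq_integral_Ioo]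
    have : (fun s => {p : ℝ × ℝ | p.2 < p.1}.indicator
        (fun p => deriv η p.1 • w p.2) (t, s)) = (Iio t).indicator (fun s => deriv η t • w s) := by
      ext s; simp [indicator]
    rw [this, setIntegral_indicator measurableSet_Iio]
    congr 2
    ext s; simp only [mem_inter_iff, mem_Ioo, mem_Iio]
    exact ⟨fun h => ⟨h.1.1, h.2⟩, fun h => ⟨⟨h.1, h.2.trans ht.2⟩, h.2⟩⟩
  have hR : ∀ s ∈ Ioo (0 : ℝ) T, ∫ t in Ioo 0 T, {p : ℝ × ℝ | p.2 < p.1}.indicator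
      (fun p => deriv η p.1 • w p.2) (t, s) = -(η s • w s) := by
    intro s hs'
    have h1 : (fun t => {p : ℝ × ℝ | p.2 < p.1}.indicator
        (fun p => deriv η p.1 • w p.2) (t, s)) =
        (Ioi s).indicator (fun t => deriv η t • w s) := by
      ext t; simp [indicator]
    rw [h1, setIntegral_indicator measurableSet_Ioi]
    have h2 : Ioo (0 : ℝ) T ∩ Ioi s = Ioo s T := by
      ext t; simp only [mem_inter_iff, mem_Ioo, mem_Ioi]
      exact ⟨fun h => ⟨h.2, h.1.2⟩, fun h => ⟨⟨hs'.1.trans h.1, h.2⟩, h.1⟩⟩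
    rw [h2, integral_smul_const, ← integral_Ioc_eq_integral_Ioo,
      ← intervalIntegral.integral_of_le hs'.2.le,
      intervalIntegral.integral_deriv_eq_sub
        (fun x _ => (hη.differentiable (by simp)).differentiableAt)
        (hη'.intervalIntegrable _ _),
      eq_zero_of_tsupport_subset_Ioo hs (t := T) (by simp)]
    simp
  rw [setIntegral_congr_fun measurableSet_Ioo hL, setIntegral_congr_fun measurableSet_Ioo hR,
    integral_neg] at hswap
  exact hswap

/-- **du Bois-Reymond lemma**: a function with vanishing weak derivative is constant. -/
lemma exists_ae_eq_const_of_hasWeakTimeDeriv_zero (hT : 0 < T) {y : ℝ → X}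
    (hy : Integrable y (timeMeasure T)) (h : HasWeakTimeDeriv T y 0) :
    ∃ c : X, ∀ᵐ t ∂timeMeasure T, y t = c := by
  obtain ⟨θ₀, hθs, hθc, hθd, hθr, hθ1⟩ := exists_contDiff_tsupport_subset (n := ⊤)
    (Ioo_mem_nhds (half_pos hT) (half_lt_self hT))
  have hm : 0 < ∫ t, θ₀ t := by
    refine (hθd.continuous.integral_pos_of_hasCompactSupport_nonneg_nonzero hθc ?_ (x := T / 2) ?_)
    · intro t; exact (hθr (mem_range_self t)).1
    · simp [hθ1]
  set m := ∫ t, θ₀ t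
  refine ⟨m⁻¹ • ∫ t, θ₀ t • y t ∂timeMeasure T, ?_⟩
  -- the constant is the mean of `y` with respect to the weight `θ₀ / m`
  set c := m⁻¹ • ∫ t, θ₀ t • y t ∂timeMeasure T with hc
  rw [ae_restrict_iff' measurableSet_Ioo]
  have key := IsOpen.ae_eq_zero_of_integral_contDiff_smul_eq_zero (μ := volume)
    (f := fun t => y t - c) (isOpen_Ioo (a := (0 : ℝ)) (b := T)) ?_ ?_
  · filter_upwards [key] with t ht hmem
    exact sub_eq_zero.1 (ht hmem)
  · refine IntegrableOn.locallyIntegrableOn ?_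
    exact Integrable.sub hy (integrable_const c)
  intro η hη hηc hηs
  -- `ζ` has zero mean, so its primitive `ψ` is again a test function
  set I := ∫ t, η t with hI
  set ζ : ℝ → ℝ := fun t => η t - (I / m) * θ₀ t with hζ
  have hζd : ContDiff ℝ ∞ ζ := hη.sub (contDiff_const.mul hθd)
  have hint : ∀ {ξ : ℝ → ℝ}, Continuous ξ → HasCompactSupport ξ → Integrable ξ volume :=
    fun h1 h2 => h1.integrable_of_hasCompactSupport h2
  -- `[a, b]` is the convex hull of the union of the two supports
  have hK : IsCompact (tsupport η ∪ tsupport θ₀) := IsCompact.union hηc hθc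
  have hKs : tsupport η ∪ tsupport θ₀ ⊆ Ioo 0 T := union_subset hηs hθs
  have hKne : (tsupport η ∪ tsupport θ₀).Nonempty :=
    ⟨T / 2, Or.inr (subset_tsupport _ (by simp [hθ1]))⟩
  obtain ⟨a, haK, ha⟩ := hK.exists_isLeast hKne
  obtain ⟨b, hbK, hb⟩ := hK.exists_isGreatest hKne
  have hζ0 : ∀ t, t ∉ Icc a b → ζ t = 0 := by
    intro t ht
    have h1 : η t = 0 := by
      by_contra h0
      have := Or.inl (b := t ∈ tsupport θ₀) (subset_tsupport _ h0)
      exact ht ⟨ha this, hb this⟩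
    have h2 : θ₀ t = 0 := by
      by_contra h0
      have := Or.inr (a := t ∈ tsupport η) (subset_tsupport _ h0)
      exact ht ⟨ha this, hb this⟩
    simp [hζ, h1, h2]
  have hζi : Integrable ζ volume :=
    (hint hη.continuous hηc).sub ((hint hθd.continuous hθc).const_mul _)
  have hζI : ∫ t, ζ t = 0 := by
    rw [hζ, integral_sub (hint hη.continuous hηc) ((hint hθd.continuous hθc).const_mul _),
      integral_const_mul]
    change I - I / m * m = 0
    field_simp
    ring
  set ψ : ℝ → ℝ := fun t => ∫ s in a..t, ζ s with hψ
  have hψ' : ∀ t, HasDerivAt ψ (ζ t) t := fun t =>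
    intervalIntegral.integral_hasDerivAt_right (hζi.intervalIntegrable)
      hζd.continuous.stronglyMeasurable.stronglyMeasurableAtFilter hζd.continuous.continuousAt
  have hdψ : deriv ψ = ζ := funext fun t => (hψ' t).deriv
  have hψd : ContDiff ℝ ∞ ψ := by
    rw [contDiff_infty_iff_deriv, hdψ]
    exact ⟨fun t => (hψ' t).differentiableAt, hζd⟩
  have hψ0 : ∀ t, t ∉ Icc a b → ψ t = 0 := by
    intro t ht
    by_cases hta : t < a
    · rw [hψ]
      simp only
      rw [intervalIntegral.integral_symm, intervalIntegral.integral_of_le hta.le,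
        integral_Ioc_eq_integral_Ioo,
        setIntegral_eq_zero_of_forall_eq_zero, neg_zero]
      intro s hs
      exact hζ0 s fun h => absurd h.1 (not_le.2 hs.2)
    · have hbt : b < t := by
        by_contra hbt
        exact ht ⟨not_lt.1 hta, not_lt.1 hbt⟩
      have hab : a ≤ t := not_lt.1 hta
      rw [hψ]
      simp only
      rw [intervalIntegral.integral_of_le hab, ← integral_Icc_eq_integral_Ioc,
        setIntegral_eq_integral_of_forall_compl_eq_zero, hζI]
      intro s hs
      exact hζ0 s fun h => hs ⟨h.1, h.2.trans hbt.le⟩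
  have hψs : tsupport ψ ⊆ Icc a b :=
    closure_minimal (fun t ht => by by_contra h; exact ht (hψ0 t h)) isClosed_Icc
  have habT : Icc a b ⊆ Ioo 0 T := fun t ht =>
    ⟨(hKs haK).1.trans_le ht.1, ht.2.trans_lt (hKs hbK).2⟩
  have h0 := h ψ hψd (isCompact_Icc.of_isClosed_subset (isClosed_tsupport ψ) hψs)
    (hψs.trans habT)
  simp only [hdψ, Pi.zero_apply, smul_zero, integral_zero, neg_zero] at h0
  have hηy := integrable_smul_of_contDiff hy hη.continuous hηc
  have hθy := integrable_smul_of_contDiff hy hθd.continuous hθc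
  have e1 : ∫ t, ζ t • y t ∂timeMeasure T =
      ∫ t, η t • y t ∂timeMeasure T - I • c := by
    have : ∀ t, ζ t • y t = η t • y t - (I / m) • (θ₀ t • y t) := by
      intro t; simp only [hζ]; rw [sub_smul, mul_smul]
    simp_rw [this]
    have hθy' : Integrable (fun t => (I / m) • θ₀ t • y t) (timeMeasure T) := hθy.smul (I / m)
    rw [integral_sub hηy hθy', integral_smul, hc, smul_smul, div_eq_mul_inv]
  have e2 : ∫ t, η t • (y t - c) = ∫ t, η t • (y t - c) ∂timeMeasure T := by
    rw [setIntegral_eq_integral_of_forall_compl_eq_zero]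
    intro t ht
    rw [eq_zero_of_tsupport_subset_Ioo hηs ht, zero_smul]
  have e3 : ∫ t, η t ∂timeMeasure T = I := by
    rw [setIntegral_eq_integral_of_forall_compl_eq_zero]
    intro t ht
    exact eq_zero_of_tsupport_subset_Ioo hηs ht
  rw [e2]
  simp_rw [smul_sub]
  rw [integral_sub hηy (((hint hη.continuous hηc).mono_measure
    Measure.restrict_le_self).smul_const c), integral_smul_const, e3, ← e1, h0]

/-- A function with an integrable weak derivative is a primitive of it. -/
lemma HasWeakTimeDeriv.exists_ae_eq_primitive (hT : 0 < T) {y w : ℝ → X}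
    (hy : Integrable y (timeMeasure T)) (hw : Integrable w (timeMeasure T))
    (h : HasWeakTimeDeriv T y w) :
    ∃ c : X, ∀ᵐ t ∂timeMeasure T, y t = c + ∫ s in (0 : ℝ)..t, w s := by
  have hp : Integrable (fun t => ∫ s in (0 : ℝ)..t, w s) (timeMeasure T) :=
    IntegrableOn.mono_set ((continuousOn_primitive_timeMeasure hT hw).integrableOn_Icc)
      Ioo_subset_Icc_self
  have h0 := h.sub hy hp hw hw (hasWeakTimeDeriv_primitive hw)
  simp only [sub_self] at h0
  obtain ⟨c, hc⟩ := exists_ae_eq_const_of_hasWeakTimeDeriv_zero hT (hy.sub hp) h0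
  refine ⟨c, ?_⟩
  filter_upwards [hc] with t ht
  rw [← ht]; simp

lemma eqOn_Icc_of_ae_timeMeasure {Y : Type*} [TopologicalSpace Y] [T2Space Y] (hT : 0 < T)
    {y z : ℝ → Y} (hy : ContinuousOn y (Icc 0 T)) (hz : ContinuousOn z (Icc 0 T))
    (h : ∀ᵐ t ∂timeMeasure T, y t = z t) : EqOn y z (Icc 0 T) := by
  refine Measure.eqOn_Icc_of_ae_eq (μ := volume) hT.ne ?_ hy hz
  rw [restrict_Ioo_eq_restrict_Icc.symm]
  exact h

/-- A function with an integrable weak derivative and zero initial value is the primitive that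
vanishes at `0`. -/
lemma HasWeakTimeDeriv.ae_eq_primitive (hT : 0 < T) {y w : ℝ → X}
    (hy : Integrable y (timeMeasure T)) (hw : Integrable w (timeMeasure T))
    (h : HasWeakTimeDeriv T y w) (h0 : HasInitialValue T y 0) :
    ∀ᵐ t ∂timeMeasure T, y t = ∫ s in (0 : ℝ)..t, w s := by
  obtain ⟨c, hc⟩ := h.exists_ae_eq_primitive hT hy hw
  obtain ⟨z, hz, hyz, hz0⟩ := h0
  have := eqOn_Icc_of_ae_timeMeasure hT hz
    (continuousOn_const.add (continuousOn_primitive_timeMeasure hT hw))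
    (by filter_upwards [hc, hyz] with t h1 h2; exact h2.symm.trans h1)
    (left_mem_Icc.2 hT.le)
  have hc0 : c = 0 := by simpa [hz0, eq_comm] using this
  filter_upwards [hc] with t ht
  rw [ht, hc0, zero_add]

end Time

/-! ### The order structure of `L²` -/

section Order

variable {A : Type*} [MeasurableSpace A] {μ : Measure A}

lemma inner_nonneg_of_nonneg {a b : Lp ℝ 2 μ} (ha : 0 ≤ a) (hb : 0 ≤ b) :
    0 ≤ inner ℝ a b := by
  rw [L2.inner_def]
  refine integral_nonneg_of_ae ?_
  filter_upwards [(Lp.coeFn_nonneg a).2 ha, (Lp.coeFn_nonneg b).2 hb] with x h1 h2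
  simpa using mul_nonneg h2 h1

lemma inner_posPart_negPart (a : Lp ℝ 2 μ) : inner ℝ a⁺ a⁻ = (0 : ℝ) := by
  rw [L2.inner_def]
  refine integral_eq_zero_of_ae ?_
  filter_upwards [Lp.coeFn_sup a 0, Lp.coeFn_sup (-a) 0, Lp.coeFn_neg a, Lp.coeFn_zero ℝ 2 μ]
    with x h1 h2 h3 h4
  rw [posPart_def, negPart_def, h1, h2]
  simp only [Pi.sup_apply, h3, h4, Pi.neg_apply, Pi.zero_apply]
  rcases le_total (a x) 0 with h | h <;> simp [h]

lemma inner_self_posPart (a : Lp ℝ 2 μ) : inner ℝ a a⁺ = ‖a⁺‖ ^ 2 := by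
  rw [← real_inner_self_eq_norm_sq]
  nth_rw 1 [← posPart_sub_negPart a]
  rw [inner_sub_left, real_inner_comm, real_inner_comm _ a⁻, inner_posPart_negPart, sub_zero]

lemma inner_le_inner_posPart (a : Lp ℝ 2 μ) {b : Lp ℝ 2 μ} (hb : 0 ≤ b) :
    inner ℝ a b ≤ inner ℝ a⁺ b := by
  rw [← sub_nonneg, ← inner_sub_left]
  exact inner_nonneg_of_nonneg (sub_nonneg.2 (le_posPart a)) hb

lemma inner_nonpos_of_nonpos_of_nonneg {a b : Lp ℝ 2 μ} (ha : a ≤ 0) (hb : 0 ≤ b) :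
    inner ℝ a b ≤ (0 : ℝ) := by
  have := inner_nonneg_of_nonneg (neg_nonneg.2 ha) hb
  rw [inner_neg_left] at this
  linarith

/-- Convexity of `a ↦ ½ ‖a⁺‖²`, whose derivative is `a⁺`. -/
lemma half_sq_norm_posPart_sub_le (a b : Lp ℝ 2 μ) :
    (‖a⁺‖ ^ 2 - ‖b⁺‖ ^ 2) / 2 ≤ inner ℝ (a - b) a⁺ := by
  have h1 := inner_le_inner_posPart b (posPart_nonneg a)
  have h2 : inner ℝ b⁺ a⁺ ≤ (‖a⁺‖ ^ 2 + ‖b⁺‖ ^ 2) / 2 := by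
    nlinarith [real_inner_le_norm b⁺ a⁺, sq_nonneg (‖a⁺‖ - ‖b⁺‖)]
  rw [inner_sub_left, inner_self_posPart]
  linarith

end Order

/-! ### A nonnegativity property of the time derivative -/

section Bilinear

variable {A E F G : Type*} [MeasurableSpace A] {μ : Measure A}
  [NormedAddCommGroup E] [NormedSpace ℝ E] [NormedAddCommGroup F] [NormedSpace ℝ F]
  [NormedAddCommGroup G] [NormedSpace ℝ G]

lemma integrable_bilin (B : E →L[ℝ] F →L[ℝ] G) {f : A → E} {g : A → F} (hf : MemLp f 2 μ)
    (hg : MemLp g 2 μ) : Integrable (fun x => B (f x) (g x)) μ := by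
  rw [← memLp_one_iff_integrable]
  exact B.memLp_of_bilin 1 hf hg

lemma integrable_inner_of_memLp {E : Type*} [NormedAddCommGroup E] [InnerProductSpace ℝ E]
    {f g : A → E} (hf : MemLp f 2 μ) (hg : MemLp g 2 μ) :
    Integrable (fun x => (inner ℝ (f x) (g x) : ℝ)) μ :=
  integrable_bilin (innerSL ℝ) hf hg

end Bilinear

section Translation

variable {V : Type*} [NormedAddCommGroup V] [NormedSpace ℝ V]

lemma memLp_comp_sub_right {E : Type*} [NormedAddCommGroup E] {f : ℝ → E}
    (hf : MemLp f 2 volume) (s : ℝ) : MemLp (fun t => f (t - s)) 2 volume :=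
  hf.comp_measurePreserving (measurePreserving_sub_right volume s)

/-- Translations act continuously on `L²(ℝ)`. -/
lemma continuous_integral_translate {w : ℝ → StrongDual ℝ V} {p : ℝ → V}
    (hw : MemLp w 2 volume) (hp : MemLp p 2 volume) :
    Continuous fun s => ∫ t, w (t - s) (p t) := by
  let g : ℝ → C(ℝ, ℝ) := fun s =>
    ContinuousMap.curry ⟨fun q : ℝ × ℝ => q.2 - q.1, by fun_prop⟩ s
  have hg : Continuous g := ContinuousMap.continuous _
  have hgm : ∀ s, MeasurePreserving (g s) volume volume := fun s =>
    measurePreserving_sub_right volume s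
  have hc : Continuous fun s => (Lp.compMeasurePreserving (g s) (hgm s)) (hw.toLp w) :=
    continuous_const.compMeasurePreservingLp hg hgm (by simp)
  have hB := (((ContinuousLinearMap.id ℝ (StrongDual ℝ V)).lpPairing volume 2 2).continuous.comp
    hc).clm_apply (continuous_const (y := hp.toLp p))
  refine hB.congr fun s => ?_
  simp only [Function.comp_apply]
  rw [Lp.toLp_compMeasurePreserving, ContinuousLinearMap.lpPairing_eq_integral]
  refine integral_congr_ae ?_
  filter_upwards [(hw.comp_measurePreserving (hgm s)).coeFn_toLp, hp.coeFn_toLp] with t h1 h2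
  rw [h1, h2]
  rfl

lemma integrable_translate_prod {w : ℝ → StrongDual ℝ V} {p : ℝ → V}
    (hw : MemLp w 2 volume) (hp : MemLp p 2 volume) (ν : Measure ℝ) [IsFiniteMeasure ν] :
    Integrable (fun q : ℝ × ℝ => w (q.1 - q.2) (p q.1)) (volume.prod ν) := by
  have hmp := measurePreserving_sub_prod (volume : Measure ℝ) ν
  have hw1 : AEStronglyMeasurable (fun q : ℝ × ℝ => w (q.1 - q.2)) (volume.prod ν) :=
    (hw.1.comp_fst (ν := ν)).comp_measurePreserving hmp
  have hw2 : Integrable (fun q : ℝ × ℝ => ‖w (q.1 - q.2)‖ ^ 2) (volume.prod ν) :=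
    hmp.integrable_comp_of_integrable
      (g := fun q : ℝ × ℝ => ‖w q.1‖ ^ 2) (hw.integrable_norm_pow (by simp) |>.comp_fst ν)
  have hp2 : Integrable (fun q : ℝ × ℝ => ‖p q.1‖ ^ 2) (volume.prod ν) :=
    (hp.integrable_norm_pow (by simp)).comp_fst ν
  refine (hw2.add hp2).mono' ((ContinuousLinearMap.id ℝ
    (StrongDual ℝ V)).aestronglyMeasurable_comp₂ hw1 (hp.1.comp_fst (ν := ν))) (ae_of_all _ ?_)
  intro q
  have := (w (q.1 - q.2)).le_opNorm (p q.1)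
  simp only [Pi.add_apply]
  nlinarith [sq_nonneg (‖w (q.1 - q.2)‖ - ‖p q.1‖), sq_nonneg (‖w (q.1 - q.2)‖),
    sq_nonneg (‖p q.1‖)]

/-- If the pairings of `p` with the running integrals of `w` over `(t - h, t)` are nonnegative,
then so is the pairing of `p` with `w`: divide by `h` and let `h → 0`. -/
lemma integral_nonneg_of_integral_primitive_nonneg {w : ℝ → StrongDual ℝ V} {p : ℝ → V}
    (hw : MemLp w 2 volume) (hp : MemLp p 2 volume)
    (h : ∀ h > 0, 0 ≤ ∫ t, (∫ s in (t - h)..t, w s) (p t)) : 0 ≤ ∫ t, w t (p t) := by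
  -- Fubini turns the hypothesis into nonnegativity of the integrals of `F` over `(0, h)`
  have hF := continuous_integral_translate hw hp
  set F : ℝ → ℝ := fun s => ∫ t, w (t - s) (p t) with hFdef
  have hloc : LocallyIntegrable w volume := hw.locallyIntegrable one_le_two
  have hI : ∀ h > 0, 0 ≤ ∫ s in (0 : ℝ)..h, F s := by
    intro h' hh
    have : IsFiniteMeasure (volume.restrict (uIoc 0 h')) := by rw [uIoc]; infer_instance
    have hsw : ∫ s in (0 : ℝ)..h', F s = ∫ t, ∫ s in (0 : ℝ)..h', w (t - s) (p t) :=
      intervalIntegral_integral_swap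
        (integrable_translate_prod hw hp (volume.restrict (uIoc 0 h'))).swap
    rw [hsw]
    refine (h h' hh).trans_eq (integral_congr_ae (ae_of_all _ fun t => ?_))
    simp only
    have e1 : ∫ s in (t - h')..t, w s = ∫ s in (0 : ℝ)..h', w (t - s) := by
      rw [intervalIntegral.integral_comp_sub_left w t, sub_zero]
    have hii : IntervalIntegrable (fun s => w (t - s)) volume 0 h' := by
      have h1 : IntervalIntegrable w volume (t - 0) (t - h') :=
        hloc.integrableOn_isCompact isCompact_uIcc |>.intervalIntegrable
      simpa using h1.comp_sub_left t
    rw [e1]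
    exact (ContinuousLinearMap.intervalIntegral_apply hii (p t))
  have hd : HasDerivAt (fun u => ∫ s in (0 : ℝ)..u, F s) (F 0) 0 :=
    intervalIntegral.integral_hasDerivAt_right (by simp)
      hF.stronglyMeasurable.stronglyMeasurableAtFilter hF.continuousAt
  have hlim := hd.tendsto_slope.mono_left (nhdsWithin_mono 0
    (fun x (hx : 0 < x) => ne_of_gt hx) : 𝓝[>] (0 : ℝ) ≤ 𝓝[≠] 0)
  have : 0 ≤ F 0 := by
    refine ge_of_tendsto hlim ?_
    filter_upwards [self_mem_nhdsWithin] with u (hu : 0 < u)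
    rw [slope_def_field]
    simp only [intervalIntegral.integral_same, sub_zero]
    exact div_nonneg (hI u hu) hu.le
  simpa [hFdef] using this

end Translation

/-- If `w` is the time derivative of `a y`, in the dual of a space `V` that is mapped to `L²` by
`ι`, if `a y` vanishes initially, and if `P` lifts `y⁺` to `V`, then `∫ ⟨w, P⟩ ≥ 0`. Indeed the
integral is formally `(a / 2) ‖y⁺(T)‖²`; replacing the derivative by backward difference quotients
and using the convexity of `½ ‖·⁺‖²` avoids the chain rule. -/
lemma integral_apply_posPart_nonneg {A V : Type*} [MeasurableSpace A] {μ : Measure A}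
    [NormedAddCommGroup V] [NormedSpace ℝ V] (ι : V →L[ℝ] Lp ℝ 2 μ) {T a : ℝ}
    (ha : 0 ≤ a) {y : ℝ → Lp ℝ 2 μ} {P : ℝ → V} {w : ℝ → StrongDual ℝ V}
    (hy : IsL2InTime T y) (hP : IsL2InTime T P) (hw : IsL2InTime T w)
    (hι : ∀ᵐ t ∂timeMeasure T, ι (P t) = (y t)⁺)
    (hD : ∀ᵐ t ∂timeMeasure T, (innerSL ℝ (a • y t)).comp ι = ∫ s in (0 : ℝ)..t, w s) :
    0 ≤ ∫ t, w t (P t) ∂timeMeasure T := by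
  set I := Ioo (0 : ℝ) T
  have hIm : MeasurableSet I := measurableSet_Ioo
  -- extension by zero to the whole line; the vanishing initial value makes `w'` the derivative of
  -- `a y'` also across `t = 0`
  set w' := I.indicator w with hw'
  set y' := I.indicator y with hy'
  set P' := I.indicator P with hP'
  have hw2 : MemLp w' 2 volume := (memLp_indicator_iff_restrict hIm).2 hw
  have hy2 : MemLp y' 2 volume := (memLp_indicator_iff_restrict hIm).2 hy
  have hP2 : MemLp P' 2 volume := (memLp_indicator_iff_restrict hIm).2 hP
  have hloc : LocallyIntegrable w' volume := hw2.locallyIntegrable one_le_two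
  have hii : ∀ a b, IntervalIntegrable w' volume a b := fun a b =>
    (hloc.integrableOn_isCompact isCompact_uIcc).intervalIntegrable
  have hprim : ∀ᵐ t : ℝ, t < T →
      (innerSL ℝ (a • y' t)).comp ι = ∫ s in (0 : ℝ)..t, w' s := by
    rw [ae_restrict_iff' hIm] at hD
    filter_upwards [hD] with t ht htT
    by_cases h0 : 0 < t
    · rw [hy', indicator_of_mem (show t ∈ I from ⟨h0, htT⟩), ht ⟨h0, htT⟩]
      rw [intervalIntegral.integral_of_le h0.le, intervalIntegral.integral_of_le h0.le]
      exact setIntegral_congr_fun measurableSet_Ioc fun s hs =>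
        (indicator_of_mem (show s ∈ I from ⟨hs.1, hs.2.trans_lt htT⟩) w).symm
    · rw [hy', indicator_of_notMem (fun h => h0 h.1),
        intervalIntegral.integral_symm, intervalIntegral.integral_of_le (not_lt.1 h0),
        setIntegral_eq_zero_of_forall_eq_zero]
      · ext; simp
      · intro s hs
        exact indicator_of_notMem (fun h => absurd h.1 (not_lt.2 hs.2)) w
  have hlift : ∀ᵐ t : ℝ, ι (P' t) = (y' t)⁺ := by
    rw [ae_restrict_iff' hIm] at hι
    filter_upwards [hι] with t ht
    by_cases h : t ∈ I
    · simp [hP', hy', h, ht h]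
    · simp [hP', hy', h]
  have hpos : MemLp (fun t => (y' t)⁺) 2 volume :=
    lipschitzWith_posPart.comp_memLp (by simp) hy2
  have key : 0 ≤ ∫ t, w' t (P' t) := by
    refine integral_nonneg_of_integral_primitive_nonneg hw2 hP2 fun h hh => ?_
    have e : ∀ᵐ t : ℝ, (∫ s in (t - h)..t, w' s) (P' t) =
        a * inner ℝ (y' t - y' (t - h)) (y' t)⁺ := by
      filter_upwards [hprim, (measurePreserving_sub_right volume
        h).quasiMeasurePreserving.ae hprim, hlift] with t h1 h2 h3
      by_cases ht : t ∈ I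
      · have h2' := h2 (by linarith [ht.2])
        rw [← intervalIntegral.integral_interval_sub_left (hii 0 t) (hii 0 (t - h)),
          ← h1 ht.2, ← h2']
        simp only [sub_apply, ContinuousLinearMap.comp_apply, innerSL_apply_apply,
          h3, real_inner_smul_left, inner_sub_left]
        ring
      · simp [hP', hy', ht]
    rw [integral_congr_ae e, integral_const_mul]
    refine mul_nonneg ha ?_
    -- translation invariance: the two integrals of `‖y'⁺‖²` cancel
    have hsq : Integrable (fun t => ‖(y' t)⁺‖ ^ 2) volume := hpos.integrable_norm_pow (by simp)
    have hsq' : Integrable (fun t => ‖(y' (t - h))⁺‖ ^ 2) volume := hsq.comp_sub_right h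
    calc (0 : ℝ) = ∫ t, (‖(y' t)⁺‖ ^ 2 - ‖(y' (t - h))⁺‖ ^ 2) / 2 := by
          rw [integral_div, integral_sub hsq hsq',
            integral_sub_right_eq_self (fun t => ‖(y' t)⁺‖ ^ 2) h, sub_self, zero_div]
      _ ≤ _ := integral_mono ((hsq.sub hsq').div_const 2)
          (integrable_inner_of_memLp (hy2.sub (memLp_comp_sub_right hy2 h)) hpos)
          fun t => half_sq_norm_posPart_sub_le _ _
  have e2 : ∀ t, w' t (P' t) = I.indicator (fun t => w t (P t)) t := by
    intro t
    by_cases ht : t ∈ I <;> simp [hw', hP', ht]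
  simp_rw [e2] at key
  rwa [integral_indicator hIm] at key

/-! ### Test functions, the Poincaré inequality and truncation in `H¹₀` -/

section Space

variable {n : ℕ} {Ω : Set (EuclideanSpace ℝ (Fin n))}

lemma memLp_of_test {F : Type*} [NormedAddCommGroup F] {φ : EuclideanSpace ℝ (Fin n) → F}
    (hφ : Continuous φ) (hc : HasCompactSupport φ) : MemLp φ 2 (volume.restrict Ω) :=
  (hφ.memLp_of_hasCompactSupport hc).restrict Ω

lemma gradient_eq_zero_of_notMem_tsupport {φ : EuclideanSpace ℝ (Fin n) → ℝ}
    {x : EuclideanSpace ℝ (Fin n)} (hx : x ∉ tsupport φ) : gradient φ x = 0 := by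
  have : fderiv ℝ φ x = 0 := by
    by_contra h
    exact hx (support_fderiv_subset ℝ h)
  simp [gradient, this]

lemma continuous_gradient {φ : EuclideanSpace ℝ (Fin n) → ℝ} (hφ : ContDiff ℝ ∞ φ) :
    Continuous (gradient φ) :=
  (LinearIsometryEquiv.continuous _).comp (hφ.continuous_fderiv (by simp))

lemma hasCompactSupport_gradient {φ : EuclideanSpace ℝ (Fin n) → ℝ}
    (hc : HasCompactSupport φ) : HasCompactSupport (gradient φ) :=
  HasCompactSupport.intro hc fun _ hx => gradient_eq_zero_of_notMem_tsupport hx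

/-- The pair `(φ, ∇φ)`, for `φ ∈ C_c^∞(Ω)`. -/
def testPair (Ω : Set (EuclideanSpace ℝ (Fin n))) {φ : EuclideanSpace ℝ (Fin n) → ℝ}
    (hφ : ContDiff ℝ ∞ φ) (hc : HasCompactSupport φ) : WithLp 2 (L2 Ω × L2Vec Ω) :=
  WithLp.toLp 2 ((memLp_of_test hφ.continuous hc).toLp φ,
    (memLp_of_test (continuous_gradient hφ) (hasCompactSupport_gradient hc)).toLp (gradient φ))

lemma testPair_mem {φ : EuclideanSpace ℝ (Fin n) → ℝ} (hφ : ContDiff ℝ ∞ φ)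
    (hc : HasCompactSupport φ) (hs : tsupport φ ⊆ Ω) : testPair Ω hφ hc ∈ testPairs Ω :=
  ⟨φ, hφ, hc, hs, (memLp_of_test hφ.continuous hc).coeFn_toLp,
    (memLp_of_test (continuous_gradient hφ) (hasCompactSupport_gradient hc)).coeFn_toLp⟩

lemma span_testPairs : (Submodule.span ℝ (testPairs Ω) : Set _) = testPairs Ω := by
  refine Subset.antisymm (fun p hp => ?_) Submodule.subset_span
  induction hp using Submodule.span_induction with
  | mem p hp => exact hp
  | zero =>
    refine ⟨0, contDiff_const, HasCompactSupport.zero, by simp [tsupport], ?_, ?_⟩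
    · exact Lp.coeFn_zero ℝ 2 _
    · filter_upwards [Lp.coeFn_zero (EuclideanSpace ℝ (Fin n)) 2 (volume.restrict Ω)] with x hx
      rw [WithLp.zero_snd, hx, Pi.zero_apply]
      simp [gradient]
  | add p q _ _ hp hq =>
    obtain ⟨φ, hφ, hφc, hφs, h1, h2⟩ := hp
    obtain ⟨ψ, hψ, hψc, hψs, h3, h4⟩ := hq
    refine ⟨φ + ψ, hφ.add hψ, hφc.add hψc,
      (tsupport_add φ ψ).trans (union_subset hφs hψs), ?_, ?_⟩
    · filter_upwards [h1, h3, Lp.coeFn_add p.fst q.fst] with x a b c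
      rw [WithLp.add_fst, c, Pi.add_apply, a, b, Pi.add_apply]
    · filter_upwards [h2, h4, Lp.coeFn_add p.snd q.snd] with x a b c
      rw [WithLp.add_snd, c, Pi.add_apply, a, b]
      simp only [gradient]
      rw [fderiv_add (hφ.differentiable (by simp)).differentiableAt
        (hψ.differentiable (by simp)).differentiableAt, map_add]
  | smul r p _ hp =>
    obtain ⟨φ, hφ, hφc, hφs, h1, h2⟩ := hp
    refine ⟨r • φ, contDiff_const.smul hφ, hφc.smul_left,
      (tsupport_smul_subset_right (fun _ => r) φ).trans hφs, ?_, ?_⟩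
    · filter_upwards [h1, Lp.coeFn_smul r p.fst] with x a c
      rw [WithLp.smul_fst, c, Pi.smul_apply, a, Pi.smul_apply]
    · filter_upwards [h2, Lp.coeFn_smul r p.snd] with x a c
      rw [WithLp.smul_snd, c, Pi.smul_apply, a]
      simp only [gradient]
      rw [fderiv_const_smul (hφ.differentiable (by simp)).differentiableAt]
      simp

lemma testPairs_subset_H10 : testPairs Ω ⊆ (H10 Ω : Set (WithLp 2 (L2 Ω × L2Vec Ω))) :=
  Submodule.subset_span.trans (Submodule.le_topologicalClosure _)

/-- The elements of `H¹₀(Ω)` given by test functions. -/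
def testElements (Ω : Set (EuclideanSpace ℝ (Fin n))) : Set (H10 Ω) :=
  {x | (x : WithLp 2 (L2 Ω × L2Vec Ω)) ∈ testPairs Ω}

lemma zero_mem_testElements : (0 : H10 Ω) ∈ testElements Ω := by
  have h : (0 : WithLp 2 (L2 Ω × L2Vec Ω)) ∈ (Submodule.span ℝ (testPairs Ω) : Set _) :=
    Submodule.zero_mem _
  rw [span_testPairs] at h
  exact h

lemma dense_testElements : Dense (testElements Ω) := by
  intro x
  rw [closure_subtype]
  have h : ((↑) : H10 Ω → WithLp 2 (L2 Ω × L2Vec Ω)) '' testElements Ω = testPairs Ω := by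
    ext p
    exact ⟨fun ⟨y, hy, hyp⟩ => hyp ▸ hy, fun hp => ⟨⟨p, testPairs_subset_H10 hp⟩, hp, rfl⟩⟩
  rw [h, ← span_testPairs]
  exact x.2

instance : CompleteSpace (H10 Ω) :=
  (Submodule.isClosed_topologicalClosure _).completeSpace_coe

instance : SecondCountableTopology (H10 Ω) := by
  have : Fact ((2 : ENNReal) ≠ ⊤) := ⟨by simp⟩
  have h1 : SecondCountableTopology (L2 Ω) := Lp.SecondCountableTopology
  have h2 : SecondCountableTopology (L2Vec Ω) := Lp.SecondCountableTopology
  have : SecondCountableTopology (WithLp 2 (L2 Ω × L2Vec Ω)) :=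
    (WithLp.homeomorphProd 2 (L2 Ω) (L2Vec Ω)).secondCountableTopology
  exact inferInstanceAs (SecondCountableTopology {x // x ∈ H10 Ω})

lemma norm_sq_eq (x : H10 Ω) : ‖x‖ ^ 2 = ‖toL2 x‖ ^ 2 + ‖grad x‖ ^ 2 :=
  WithLp.prod_norm_sq_eq_of_L2 (x : WithLp 2 (L2 Ω × L2Vec Ω))

/-- The **Poincaré inequality** in `H¹₀(Ω)`, for bounded `Ω`. -/
lemma exists_norm_toL2_le (hn : 3 ≤ n) (hΩ : Bornology.IsBounded Ω) :
    ∃ C : ℝ, 0 ≤ C ∧ ∀ x : H10 Ω, ‖toL2 x‖ ≤ C * ‖grad x‖ := by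
  set C := eLpNormLESNormFDerivOfLeConst ℝ
    (volume : Measure (EuclideanSpace ℝ (Fin n))) Ω 2 2
  refine ⟨C, C.2, fun x => ?_⟩
  refine dense_testElements.induction (P := fun x : H10 Ω => ‖toL2 x‖ ≤ C * ‖grad x‖) ?_
    (isClosed_le (by fun_prop) (by fun_prop)) x
  rintro x ⟨φ, hφ, hc, hs, h1, h2⟩
  have hGNS := eLpNorm_le_eLpNorm_fderiv (volume : Measure (EuclideanSpace ℝ (Fin n)))
    (hφ.of_le (by simp)) ((subset_tsupport φ).trans hs) (p := 2) (by norm_num)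
    (by simp only [finrank_euclideanSpace_fin]; exact_mod_cast hn) hΩ
  have e1 : eLpNorm (x : WithLp 2 (L2 Ω × L2Vec Ω)).fst 2 (volume.restrict Ω) ≤
      eLpNorm φ 2 volume :=
    (eLpNorm_congr_ae h1).trans_le (eLpNorm_mono_measure _ Measure.restrict_le_self)
  have e2 : eLpNorm (fderiv ℝ φ) 2 volume =
      eLpNorm (x : WithLp 2 (L2 Ω × L2Vec Ω)).snd 2 (volume.restrict Ω) := by
    rw [eLpNorm_congr_ae h2, eLpNorm_restrict_eq_of_support_subset]
    · exact eLpNorm_congr_norm_ae (ae_of_all _ fun y => by simp [gradient])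
    · intro y hy
      by_contra h
      exact hy (gradient_eq_zero_of_notMem_tsupport fun h' => h (hs h'))
  have e3 : eLpNorm (x : WithLp 2 (L2 Ω × L2Vec Ω)).fst 2 (volume.restrict Ω) ≤
      C * eLpNorm (x : WithLp 2 (L2 Ω × L2Vec Ω)).snd 2 (volume.restrict Ω) := by
    rw [← e2]
    exact e1.trans hGNS
  have := ENNReal.toReal_mono (ENNReal.mul_ne_top (by simp) (Lp.eLpNorm_ne_top _)) e3
  rw [ENNReal.toReal_mul] at this
  exact this

/-- A smooth approximation of the positive part, namely `(√(s² + δ²) + s - δ) / 2`. -/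
lemma exists_smooth_posPart {δ : ℝ} (hδ : 0 < δ) :
    ∃ G : ℝ → ℝ, ContDiff ℝ ∞ G ∧ G 0 = 0 ∧ (∀ s, 0 ≤ deriv G s ∧ deriv G s ≤ 1) ∧
      (∀ s, |G s| ≤ |s|) ∧ ∀ s, |G s - max s 0| ≤ δ := by
  have hpos : ∀ s : ℝ, 0 < s ^ 2 + δ ^ 2 := fun s => by positivity
  have h1 : ∀ s : ℝ, |s| ≤ √(s ^ 2 + δ ^ 2) := fun s =>
    Real.abs_le_sqrt (by nlinarith [sq_nonneg δ])
  have h2 : ∀ s : ℝ, δ ≤ √(s ^ 2 + δ ^ 2) := fun s =>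
    Real.le_sqrt_of_sq_le (by nlinarith [sq_nonneg s])
  have h3 : ∀ s : ℝ, √(s ^ 2 + δ ^ 2) ≤ |s| + δ := fun s => by
    rw [Real.sqrt_le_left (by positivity)]
    nlinarith [sq_abs s, mul_nonneg (abs_nonneg s) hδ.le]
  refine ⟨fun s => (√(s ^ 2 + δ ^ 2) + s - δ) / 2, ?_, ?_, fun s => ?_, fun s => ?_, fun s => ?_⟩
  · refine ContDiff.div_const (ContDiff.sub (ContDiff.add ?_ contDiff_id) contDiff_const) 2
    exact ((contDiff_id.pow 2).add contDiff_const).sqrt fun s => (hpos s).ne'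
  · simp [Real.sqrt_sq hδ.le]
  · have hd : HasDerivAt (fun s => (√(s ^ 2 + δ ^ 2) + s - δ) / 2)
        ((2 * s / (2 * √(s ^ 2 + δ ^ 2)) + 1) / 2) s := by
      have h4 : HasDerivAt (fun s : ℝ => s ^ 2 + δ ^ 2) (2 * s) s := by
        simpa using (hasDerivAt_pow 2 s).add_const (δ ^ 2)
      exact (((h4.sqrt (hpos s).ne').add (hasDerivAt_id s)).sub_const δ).div_const 2
    rw [hd.deriv, mul_div_mul_left _ _ two_ne_zero]
    have := abs_le.1 (h1 s)
    have hs : 0 < √(s ^ 2 + δ ^ 2) := Real.sqrt_pos.2 (hpos s)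
    have h5 : -1 ≤ s / √(s ^ 2 + δ ^ 2) := by rw [le_div_iff₀ hs]; linarith
    have h6 : s / √(s ^ 2 + δ ^ 2) ≤ 1 := by rw [div_le_iff₀ hs]; linarith
    constructor <;> linarith
  · have a := h1 s; have b := h2 s; have c := h3 s
    rcases le_total 0 s with h | h
    · rw [abs_of_nonneg h] at *
      rw [abs_le]; constructor <;> linarith
    · rw [abs_of_nonpos h] at *
      rw [abs_le]; constructor <;> linarith
  · have a := h1 s; have b := h2 s; have c := h3 s
    rcases le_total 0 s with h | h
    · rw [abs_of_nonneg h] at *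
      rw [max_eq_left h, abs_le]; constructor <;> linarith
    · rw [abs_of_nonpos h] at *
      rw [max_eq_right h, abs_le]; constructor <;> linarith

lemma gradient_comp {φ : EuclideanSpace ℝ (Fin n) → ℝ} {G : ℝ → ℝ} (hφ : Differentiable ℝ φ)
    (hG : Differentiable ℝ G) (x : EuclideanSpace ℝ (Fin n)) :
    gradient (G ∘ φ) x = deriv G (φ x) • gradient φ x := by
  simp only [gradient]
  rw [((hG (φ x)).hasDerivAt.comp_hasFDerivAt x (hφ x).hasFDerivAt).fderiv, map_smul]

/-- Approximate truncation: composition with a smooth approximation of the positive part. -/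
lemma exists_approx_posPart (hΩ : Bornology.IsBounded Ω) {x : H10 Ω} (hx : x ∈ testElements Ω)
    {ε : ℝ} (hε : 0 < ε) :
    ∃ e : H10 Ω, ‖toL2 e - (toL2 x)⁺‖ ≤ ε ∧ ‖toL2 e‖ ≤ ‖toL2 x‖ ∧
      ‖grad e‖ ^ 2 ≤ inner ℝ (grad x) (grad e) := by
  have : IsFiniteMeasure (volume.restrict Ω) := ⟨by
    simpa using hΩ.measure_lt_top⟩
  obtain ⟨φ, hφ, hc, hs, h1, h2⟩ := hx
  set m : ℝ := (measureUnivNNReal (volume.restrict Ω) : ℝ) ^ (ENNReal.toReal 2)⁻¹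
  have hm : 0 ≤ m := by positivity
  obtain ⟨G, hG, hG0, hG', hGabs, hGapp⟩ := exists_smooth_posPart
    (δ := ε / (m + 1)) (by positivity)
  have hψ : ContDiff ℝ ∞ (G ∘ φ) := hG.comp hφ
  have hψc : HasCompactSupport (G ∘ φ) := hc.comp_left hG0
  have hψs : tsupport (G ∘ φ) ⊆ Ω :=
    (closure_mono (Function.support_comp_subset hG0 φ)).trans hs
  set e : H10 Ω := ⟨testPair Ω hψ hψc, testPairs_subset_H10 (testPair_mem hψ hψc hψs)⟩
  have e1 : ∀ᵐ y ∂volume.restrict Ω, toL2 e y = G (φ y) :=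
    (memLp_of_test hψ.continuous hψc).coeFn_toLp
  have e2 : ∀ᵐ y ∂volume.restrict Ω, grad e y = deriv G (φ y) • gradient φ y := by
    filter_upwards [(memLp_of_test (Ω := Ω) (continuous_gradient hψ)
      (hasCompactSupport_gradient hψc)).coeFn_toLp] with y hy
    rw [← gradient_comp (hφ.differentiable (by simp)) (hG.differentiable (by simp))]
    exact hy
  have h1' : ∀ᵐ y ∂volume.restrict Ω, toL2 x y = φ y := h1
  have h2' : ∀ᵐ y ∂volume.restrict Ω, grad x y = gradient φ y := h2
  refine ⟨e, ?_, ?_, ?_⟩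
  · have hb : ∀ᵐ y ∂volume.restrict Ω, ‖(toL2 e - (toL2 x)⁺ : L2 Ω) y‖ ≤ ε / (m + 1) := by
      filter_upwards [e1, h1', Lp.coeFn_sub (toL2 e) (toL2 x)⁺, Lp.coeFn_sup (toL2 x) 0,
        Lp.coeFn_zero ℝ 2 (volume.restrict Ω)] with y a b c d f
      rw [c, Pi.sub_apply, posPart_def, d, Pi.sup_apply, f, a, b]
      exact hGapp (φ y)
    refine (Lp.norm_le_of_ae_bound (by positivity) hb).trans ?_
    change m * (ε / (m + 1)) ≤ ε
    rw [mul_div_assoc', div_le_iff₀ (by positivity)]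
    nlinarith
  · refine Lp.norm_le_norm_of_ae_le ?_
    filter_upwards [e1, h1'] with y a b
    rw [a, b]
    exact hGabs (φ y)
  · rw [← real_inner_self_eq_norm_sq, L2.inner_def, L2.inner_def]
    refine integral_mono_ae (L2.integrable_inner _ _) (L2.integrable_inner _ _) ?_
    filter_upwards [e2, h2'] with y a b
    rw [a, b, real_inner_smul_left]
    have h3 : 0 ≤ inner ℝ (gradient φ y) (deriv G (φ y) • gradient φ y) := by
      rw [real_inner_smul_right, real_inner_self_eq_norm_sq]
      exact mul_nonneg (hG' _).1 (sq_nonneg _)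
    exact mul_le_of_le_one_left h3 (hG' _).2

end Space

/-! ### Weak compactness -/

/-- Bounded sequences in a Hilbert space converge weakly along an ultrafilter. -/
lemma exists_weak_limit {H : Type*} [NormedAddCommGroup H] [InnerProductSpace ℝ H]
    [CompleteSpace H] {p : ℕ → H} {M : ℝ} (hp : ∀ k, ‖p k‖ ≤ M) :
    ∃ (U : Filter ℕ) (q : H), U.NeBot ∧ U ≤ atTop ∧
      ∀ x, Tendsto (fun k => (inner ℝ (p k) x : ℝ)) U (𝓝 (inner ℝ q x)) := by
  have hK := WeakDual.isCompact_closedBall (𝕜 := ℝ) (0 : StrongDual ℝ H) M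
  set U : Ultrafilter ℕ := Ultrafilter.of atTop
  let F : ℕ → WeakDual ℝ H := fun k => StrongDual.toWeakDual (InnerProductSpace.toDual ℝ H (p k))
  obtain ⟨ℓ, -, hℓ⟩ := hK.ultrafilter_le_nhds (U.map F) (by
    rw [le_principal_iff]
    refine mem_map.2 (univ_mem' fun k => ?_)
    simpa [F] using hp k)
  refine ⟨U, (InnerProductSpace.toDual ℝ H).symm (WeakDual.toStrongDual ℓ), inferInstance,
    Ultrafilter.of_le atTop, fun x => ?_⟩
  have h1 : Tendsto (fun k => F k x) U (𝓝 (ℓ x)) :=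
    ((WeakDual.eval_continuous x).tendsto ℓ).comp hℓ
  rw [InnerProductSpace.toDual_symm_apply]
  exact h1

/-- Bounded operators preserve weak convergence. -/
lemma tendsto_inner_map {H K ι : Type*} [NormedAddCommGroup H] [InnerProductSpace ℝ H]
    [CompleteSpace H] [NormedAddCommGroup K] [InnerProductSpace ℝ K] [CompleteSpace K]
    {U : Filter ι} {p : ι → H} {q : H}
    (hq : ∀ x, Tendsto (fun k => (inner ℝ (p k) x : ℝ)) U (𝓝 (inner ℝ q x)))
    (S : H →L[ℝ] K) (z : K) :
    Tendsto (fun k => (inner ℝ (S (p k)) z : ℝ)) U (𝓝 (inner ℝ (S q) z)) := by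
  simp_rw [← ContinuousLinearMap.adjoint_inner_right]
  exact hq _

/-- The pairing of a strongly convergent with a bounded weakly convergent family. -/
lemma tendsto_inner_of_weak {H ι : Type*} [NormedAddCommGroup H] [InnerProductSpace ℝ H]
    {U : Filter ι} {p x : ι → H} {q y : H} {M : ℝ} (hp : ∀ k, ‖p k‖ ≤ M)
    (hq : ∀ z, Tendsto (fun k => (inner ℝ (p k) z : ℝ)) U (𝓝 (inner ℝ q z)))
    (hx : Tendsto x U (𝓝 y)) :
    Tendsto (fun k => (inner ℝ (p k) (x k) : ℝ)) U (𝓝 (inner ℝ q y)) := by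
  have h0 : Tendsto (fun k => (inner ℝ (p k) (x k - y) : ℝ)) U (𝓝 0) := by
    refine squeeze_zero_norm (a := fun k => M * ‖x k - y‖) (fun k => ?_) ?_
    · exact (norm_inner_le_norm _ _).trans (by gcongr; exact hp k)
    · simpa using (tendsto_iff_norm_sub_tendsto_zero.1 hx).const_mul M
  have := h0.add (hq y)
  simpa [inner_sub_right] using this

/-- The inequality `‖p‖² ≤ ⟪x, p⟫` is stable under weak limits of `p` and strong limits of `x`. -/
lemma norm_sq_le_inner_of_weak {H ι : Type*} [NormedAddCommGroup H] [InnerProductSpace ℝ H]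
    {U : Filter ι} [U.NeBot] {p x : ι → H} {q y : H} {M : ℝ} (hp : ∀ k, ‖p k‖ ≤ M)
    (hq : ∀ z, Tendsto (fun k => (inner ℝ (p k) z : ℝ)) U (𝓝 (inner ℝ q z)))
    (hx : Tendsto x U (𝓝 y)) (h : ∀ k, ‖p k‖ ^ 2 ≤ inner ℝ (x k) (p k)) :
    ‖q‖ ^ 2 ≤ inner ℝ y q := by
  have hl1 : Tendsto (fun k => 2 * inner ℝ (p k) q - ‖q‖ ^ 2) U
      (𝓝 (2 * inner ℝ q q - ‖q‖ ^ 2)) := ((hq q).const_mul 2).sub_const _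
  have := le_of_tendsto_of_tendsto' hl1 (tendsto_inner_of_weak hp hq hx) fun k => by
    rw [real_inner_comm (x k)]
    nlinarith [h k, real_inner_le_norm (p k) q, sq_nonneg (‖p k‖ - ‖q‖)]
  rw [real_inner_self_eq_norm_sq, real_inner_comm] at this
  linarith

lemma norm_sq_le_inner_of_ae {A W : Type*} [MeasurableSpace A] {μ : Measure A}
    [NormedAddCommGroup W] [InnerProductSpace ℝ W] {f g : Lp W 2 μ}
    (h : ∀ᵐ t ∂μ, ‖f t‖ ^ 2 ≤ inner ℝ (g t) (f t)) : ‖f‖ ^ 2 ≤ inner ℝ g f := by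
  rw [← real_inner_self_eq_norm_sq, L2.inner_def, L2.inner_def]
  refine integral_mono_ae (L2.integrable_inner _ _) (L2.integrable_inner _ _) ?_
  filter_upwards [h] with t ht
  rwa [real_inner_self_eq_norm_sq]

/-! ### The positive part of a function with values in `H¹₀` -/

section Lift

/-- A truncation defined on a dense set `D ⊆ V` lifts to `L²`-functions with values in `V`. Here
`ι : V → L²` and `γ : V → W` determine the norm of `V`. The lift is a weak limit of truncations of
simple functions with values in `D`, so that no measurable selection is needed. -/
lemma exists_lift_posPart_of_dense {V W B A : Type*}
    [NormedAddCommGroup V] [InnerProductSpace ℝ V] [CompleteSpace V] [SecondCountableTopology V]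
    [NormedAddCommGroup W] [InnerProductSpace ℝ W] [CompleteSpace W]
    [MeasurableSpace B] {ν : Measure B} (ι : V →L[ℝ] Lp ℝ 2 ν) (γ : V →L[ℝ] W)
    (hnorm : ∀ x, ‖x‖ ^ 2 = ‖ι x‖ ^ 2 + ‖γ x‖ ^ 2)
    {D : Set V} (hD : Dense D) (hD0 : (0 : V) ∈ D)
    (hτ : ∀ x ∈ D, ∀ ε > (0 : ℝ), ∃ e : V, ‖ι e - (ι x)⁺‖ ≤ ε ∧ ‖ι e‖ ≤ ‖ι x‖ ∧
      ‖γ e‖ ^ 2 ≤ inner ℝ (γ x) (γ e))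
    [MeasurableSpace A] {μ : Measure A} [IsFiniteMeasure μ] {u : A → V} (hu : MemLp u 2 μ) :
    ∃ P : A → V, MemLp P 2 μ ∧ (∀ᵐ t ∂μ, ι (P t) = (ι (u t))⁺) ∧
      ∫ t, ‖γ (P t)‖ ^ 2 ∂μ ≤ ∫ t, inner ℝ (γ (u t)) (γ (P t)) ∂μ := by
  borelize V
  set u' := hu.1.mk u
  have hu' : Measurable u' := hu.1.stronglyMeasurable_mk.measurable
  have huu' : u =ᵐ[μ] u' := hu.1.ae_eq_mk
  have hu'2 : MemLp u' 2 μ := hu.ae_eq huu'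
  have hsep : TopologicalSpace.SeparableSpace D := inferInstance
  -- approximate `u` by simple functions with values in `D`
  set a : ℕ → SimpleFunc A V :=
    SimpleFunc.approxOn u' hu' D 0 hD0
  have ha_mem : ∀ k t, a k t ∈ D := fun k t =>
    SimpleFunc.approxOn_mem hu' hD0 k t
  have ha2 : ∀ k, MemLp (a k) 2 μ := fun k => SimpleFunc.memLp_of_isFiniteMeasure _ _ _
  have hlim : Tendsto (fun k => eLpNorm (⇑(a k) - u') 2 μ) atTop (𝓝 0) :=
    SimpleFunc.tendsto_approxOn_Lp_eLpNorm hu' hD0 (by simp)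
      (ae_of_all _ fun t => hD _) (by simpa using hu'2.eLpNorm_lt_top)
  have hLp : Tendsto (fun k => (ha2 k).toLp (a k)) atTop (𝓝 (hu'2.toLp u')) :=
    (Lp.tendsto_Lp_iff_tendsto_eLpNorm'' _ ha2 _ hu'2).2 hlim
  -- truncate the approximations
  choose! τ hτ1 hτ2 hτ3 using fun (k : ℕ) (x : V) (hx : x ∈ D) =>
    hτ x hx (1 / ((k : ℝ) + 1)) (by positivity)
  set p : ℕ → SimpleFunc A V := fun k => (a k).map (τ k)
  have hp2 : ∀ k, MemLp (p k) 2 μ := fun k => SimpleFunc.memLp_of_isFiniteMeasure _ _ _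
  have hp_le : ∀ k t, ‖p k t‖ ≤ ‖a k t‖ := by
    intro k t
    refine (sq_le_sq₀ (norm_nonneg _) (norm_nonneg _)).1 ?_
    have h1 := hτ2 k _ (ha_mem k t)
    have h2 := hτ3 k _ (ha_mem k t)
    have h3 := real_inner_le_norm (γ (a k t)) (γ (τ k (a k t)))
    rw [hnorm, hnorm]
    simp only [p, SimpleFunc.map_apply]
    have h4 : ‖γ (τ k (a k t))‖ ≤ ‖γ (a k t)‖ := by
      by_contra! h
      nlinarith [norm_nonneg (γ (a k t))]
    gcongr
  obtain ⟨M, hM⟩ := hLp.norm.bddAbove_range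
  set p' : ℕ → Lp V 2 μ := fun k => (hp2 k).toLp (p k)
  set a' : ℕ → Lp V 2 μ := fun k => (ha2 k).toLp (a k)
  set v' := hu'2.toLp u'
  have hp'M : ∀ k, ‖p' k‖ ≤ M := by
    intro k
    refine le_trans ?_ (hM (mem_range_self k))
    refine Lp.norm_le_norm_of_ae_le ?_
    filter_upwards [(hp2 k).coeFn_toLp, (ha2 k).coeFn_toLp] with t h1 h2
    rw [h1, h2]
    exact hp_le k t
  obtain ⟨U, q, hU, hUtop, hq⟩ := exists_weak_limit hp'M
  set Λ := ι.compLpL 2 μ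
  set Γ := γ.compLpL 2 μ
  have hΛ : ∀ x : Lp V 2 μ, ∀ᵐ t ∂μ, Λ x t = ι (x t) := fun x =>
    ContinuousLinearMap.coeFn_compLpL _ x
  have hΓ : ∀ x : Lp V 2 μ, ∀ᵐ t ∂μ, Γ x t = γ (x t) := fun x =>
    ContinuousLinearMap.coeFn_compLpL _ x
  have hpos2 : MemLp (fun t => (ι (u' t))⁺) 2 μ :=
    lipschitzWith_posPart.comp_memLp (by simp) (ι.comp_memLp' hu'2)
  have hstrong : Tendsto (fun k => Λ (p' k)) U (𝓝 (hpos2.toLp _)) := by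
    refine Tendsto.mono_left ?_ hUtop
    have hr2 : ∀ k, MemLp (fun t => (ι (a k t))⁺) 2 μ := fun k =>
      lipschitzWith_posPart.comp_memLp (by simp) (ι.comp_memLp' (ha2 k))
    set m : ℝ := (measureUnivNNReal μ : ℝ) ^ (ENNReal.toReal 2)⁻¹
    have hb1 : ∀ k : ℕ, ‖Λ (p' k) - (hr2 k).toLp _‖ ≤ m * (1 / ((k : ℝ) + 1)) := by
      intro k
      refine Lp.norm_le_of_ae_bound (by positivity) ?_
      filter_upwards [Lp.coeFn_sub (Λ (p' k)) ((hr2 k).toLp _), hΛ (p' k), (hp2 k).coeFn_toLp,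
        (hr2 k).coeFn_toLp] with t h1 h2 h3 h4
      rw [h1, Pi.sub_apply, h2, h3, h4]
      exact hτ1 k _ (ha_mem k t)
    have hb2 : ∀ k : ℕ, ‖(hr2 k).toLp _ - hpos2.toLp _‖ ≤ ‖Λ (a' k) - Λ v'‖ := by
      intro k
      refine Lp.norm_le_norm_of_ae_le ?_
      filter_upwards [Lp.coeFn_sub ((hr2 k).toLp _) (hpos2.toLp _), Lp.coeFn_sub (Λ (a' k)) (Λ v'),
        hΛ (a' k), hΛ v', (ha2 k).coeFn_toLp, hu'2.coeFn_toLp,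
        (hr2 k).coeFn_toLp, hpos2.coeFn_toLp] with t h1 h2 h3 h4 h5 h6 h7 h8
      rw [h1, h2, Pi.sub_apply, Pi.sub_apply, h3, h4, h5, h6, h7, h8]
      simpa using lipschitzWith_posPart.norm_sub_le (ι (a k t)) (ι (u' t))
    have hl1 : Tendsto (fun k : ℕ => m * (1 / ((k : ℝ) + 1))) atTop (𝓝 0) := by
      simpa using tendsto_one_div_add_atTop_nhds_zero_nat.const_mul m
    have hl2 : Tendsto (fun k => ‖Λ (a' k) - Λ v'‖) atTop (𝓝 0) :=
      tendsto_iff_norm_sub_tendsto_zero.1 ((Λ.continuous.tendsto v').comp hLp)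
    rw [tendsto_iff_norm_sub_tendsto_zero]
    refine squeeze_zero (fun _ => norm_nonneg _) (fun k => ?_)
      (by simpa only [add_zero] using hl1.add hl2)
    exact (norm_sub_le_norm_sub_add_norm_sub _ ((hr2 k).toLp _) _).trans
      (add_le_add (hb1 k) (hb2 k))
  have hΛq : Λ q = hpos2.toLp _ := by
    refine ext_inner_right ℝ fun z => ?_
    exact tendsto_nhds_unique (tendsto_inner_map hq Λ z) (hstrong.inner tendsto_const_nhds)
  have hΓ_le : ∀ k, ‖Γ (p' k)‖ ^ 2 ≤ inner ℝ (Γ (a' k)) (Γ (p' k)) := by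
    intro k
    refine norm_sq_le_inner_of_ae ?_
    filter_upwards [hΓ (p' k), hΓ (a' k), (hp2 k).coeFn_toLp, (ha2 k).coeFn_toLp]
      with t h1 h2 h3 h4
    rw [h1, h2, h3, h4]
    exact hτ3 k _ (ha_mem k t)
  have hΓq : ‖Γ q‖ ^ 2 ≤ inner ℝ (Γ v') (Γ q) :=
    norm_sq_le_inner_of_weak (M := ‖Γ‖ * M)
      (fun k => (Γ.le_opNorm _).trans (by gcongr; exact hp'M k)) (tendsto_inner_map hq Γ)
      ((Γ.continuous.tendsto v').comp (hLp.mono_left hUtop)) hΓ_le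
  refine ⟨q, Lp.memLp q, ?_, ?_⟩
  · filter_upwards [hΛ q, hpos2.coeFn_toLp, huu'] with t h1 h2 h3
    rw [← h1, hΛq, h2, h3]
  · rw [← real_inner_self_eq_norm_sq, L2.inner_def, L2.inner_def] at hΓq
    refine le_trans (le_of_eq ?_) (hΓq.trans (le_of_eq ?_))
    · refine integral_congr_ae ?_
      filter_upwards [hΓ q] with t h1
      rw [h1, real_inner_self_eq_norm_sq]
    · refine integral_congr_ae ?_
      filter_upwards [hΓ q, hΓ v', hu'2.coeFn_toLp, huu'] with t h1 h2 h3 h4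
      rw [h1, h2, h3, h4]

variable {n : ℕ} {Ω : Set (EuclideanSpace ℝ (Fin n))}

/-- **Stampacchia truncation** in `L²(0, T; H¹₀(Ω))`: the positive part `u⁺` lifts to
`P ∈ L²(0, T; H¹₀(Ω))`. The inequality for the gradients is all that is needed of the identity
`∇u⁺ = 1_{u > 0} ∇u`. -/
lemma exists_lift_posPart (hΩ : Bornology.IsBounded Ω) {A : Type*} [MeasurableSpace A]
    {μ : Measure A} [IsFiniteMeasure μ] {u : A → H10 Ω} (hu : MemLp u 2 μ) :
    ∃ P : A → H10 Ω, MemLp P 2 μ ∧ (∀ᵐ t ∂μ, toL2 (P t) = (toL2 (u t))⁺) ∧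
      ∫ t, ‖grad (P t)‖ ^ 2 ∂μ ≤ ∫ t, inner ℝ (grad (u t)) (grad (P t)) ∂μ :=
  exists_lift_posPart_of_dense toL2 grad norm_sq_eq dense_testElements zero_mem_testElements
    (fun _ hx _ hε => exists_approx_posPart hΩ hx hε) hu

end Lift

/-! ### Initial values and embeddings -/

section Initial

lemma HasInitialValue.sub {X : Type*} [NormedAddCommGroup X] {T : ℝ} {y₁ y₂ : ℝ → X}
    {a₁ a₂ : X} (h₁ : HasInitialValue T y₁ a₁)
    (h₂ : HasInitialValue T y₂ a₂) :
    HasInitialValue T (fun t => y₁ t - y₂ t) (a₁ - a₂) := by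
  obtain ⟨z₁, hz₁, hyz₁, h01⟩ := h₁
  obtain ⟨z₂, hz₂, hyz₂, h02⟩ := h₂
  refine ⟨fun t => z₁ t - z₂ t, hz₁.sub hz₂, ?_, by simp only [h01, h02]⟩
  filter_upwards [hyz₁, hyz₂] with t a b
  rw [a, b]

variable {X Y : Type*} [NormedAddCommGroup X] [NormedSpace ℝ X] [NormedAddCommGroup Y]
  [NormedSpace ℝ Y] {T : ℝ}

lemma HasInitialValue.map {y : ℝ → X} {y₀ : X} (h : HasInitialValue T y y₀) (S : X →L[ℝ] Y) :
    HasInitialValue T (fun t => S (y t)) (S y₀) := by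
  obtain ⟨z, hz, hyz, h0⟩ := h
  exact ⟨fun t => S (z t), S.continuous.comp_continuousOn hz,
    hyz.mono fun t ht => by simp only [ht], by simp only [h0]⟩

lemma HasWeakTimeDeriv.neg {y w : ℝ → X} (h : HasWeakTimeDeriv T y w) :
    HasWeakTimeDeriv T (fun t => -y t) (fun t => -w t) := by
  intro η h1 h2 h3
  simp only [smul_neg, integral_neg, h η h1 h2 h3]

/-- The weak derivative of the zero function vanishes. -/
lemma HasWeakTimeDeriv.ae_eq_zero [CompleteSpace X] {y w : ℝ → X}
    (hw : Integrable w (timeMeasure T)) (h : HasWeakTimeDeriv T y w)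
    (hy : ∀ᵐ t ∂timeMeasure T, y t = 0) : ∀ᵐ t ∂timeMeasure T, w t = 0 := by
  rw [ae_restrict_iff' measurableSet_Ioo]
  refine IsOpen.ae_eq_zero_of_integral_contDiff_smul_eq_zero isOpen_Ioo
    (IntegrableOn.locallyIntegrableOn hw) fun η h1 h2 h3 => ?_
  have h4 := h η h1 h2 h3
  rw [integral_eq_zero_of_ae (hy.mono fun t ht => by simp [ht]), zero_eq_neg] at h4
  rw [← h4, setIntegral_eq_integral_of_forall_compl_eq_zero]
  intro t ht
  rw [eq_zero_of_tsupport_subset_Ioo h3 ht, zero_smul]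

end Initial

lemma IsL2InTime.sub {X : Type*} [NormedAddCommGroup X] {T : ℝ} {y₁ y₂ : ℝ → X}
    (h₁ : IsL2InTime T y₁) (h₂ : IsL2InTime T y₂) : IsL2InTime T (fun t => y₁ t - y₂ t) :=
  MemLp.sub h₁ h₂

lemma IsL2InTime.const_smul {X : Type*} [NormedAddCommGroup X] [NormedSpace ℝ X] {T : ℝ}
    {y : ℝ → X} (hy : IsL2InTime T y) (a : ℝ) : IsL2InTime T (fun t => a • y t) :=
  MemLp.const_smul hy a

section Dual

variable {E V : Type*} [NormedAddCommGroup E] [InnerProductSpace ℝ E] [NormedAddCommGroup V]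
  [NormedSpace ℝ V] {T : ℝ}

/-- The transpose `E → V'` of `ι : V → E`, where `E` is identified with its dual. For `ι = toL2` it
is `toHneg1`, as a continuous linear map. -/
def innerComp (ι : V →L[ℝ] E) : E →L[ℝ] StrongDual ℝ V :=
  (ContinuousLinearMap.precomp ℝ ι).comp (innerSL ℝ : E →L[ℝ] E →L[ℝ] ℝ)

lemma IsL2InTime.innerSL_comp {y : ℝ → E} (hy : IsL2InTime T y) (ι : V →L[ℝ] E) :
    IsL2InTime T (fun t => (innerSL ℝ (y t)).comp ι) :=
  (innerComp ι).comp_memLp' hy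

lemma HasInitialValue.innerSL_comp {y : ℝ → E} (hy : HasInitialValue T y 0) (ι : V →L[ℝ] E) :
    HasInitialValue T (fun t => (innerSL ℝ (y t)).comp ι) 0 := by
  have h := hy.map (innerComp ι)
  rwa [map_zero] at h

lemma IsL2InTime.integrable_apply {w : ℝ → StrongDual ℝ V} {φ : ℝ → V} (hw : IsL2InTime T w)
    (hφ : IsL2InTime T φ) : Integrable (fun t => w t (φ t)) (timeMeasure T) :=
  integrable_bilin (ContinuousLinearMap.id ℝ (StrongDual ℝ V)) hw hφ

end Dual

section Main

variable {n : ℕ} {Ω : Set (EuclideanSpace ℝ (Fin n))} {T α β lam C₀ : ℝ}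

lemma IsL2InTime.toL2 {u : ℝ → H10 Ω} (hu : IsL2InTime T u) :
    IsL2InTime T (fun t => LimitSystem.toL2 (u t)) :=
  ContinuousLinearMap.comp_memLp' _ hu

lemma IsL2InTime.grad {u : ℝ → H10 Ω} (hu : IsL2InTime T u) :
    IsL2InTime T (fun t => LimitSystem.grad (u t)) :=
  ContinuousLinearMap.comp_memLp' _ hu

lemma IsL2InTime.toHneg1 {y : ℝ → L2 Ω} (hy : IsL2InTime T y) :
    IsL2InTime T (fun t => LimitSystem.toHneg1 (y t)) :=
  hy.innerSL_comp LimitSystem.toL2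

lemma HasInitialValue.toHneg1 {y : ℝ → L2 Ω} (hy : HasInitialValue T y 0) :
    HasInitialValue T (fun t => LimitSystem.toHneg1 (y t)) 0 :=
  hy.innerSL_comp LimitSystem.toL2

lemma toHneg1_zero : toHneg1 (0 : L2 Ω) = 0 := by
  simp [toHneg1]

lemma toHneg1_sub (y₁ y₂ : L2 Ω) : toHneg1 (y₁ - y₂) = toHneg1 y₁ - toHneg1 y₂ := by
  simp [toHneg1, ContinuousLinearMap.sub_comp]

lemma strangeCoeff_pos (hn : 3 ≤ n) (hC₀ : 0 < C₀) : 0 < strangeCoeff n C₀ := by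
  have h3 : (3 : ℝ) ≤ n := by exact_mod_cast hn
  have hS : 0 < sphereArea n := by
    rw [sphereArea, Measure.toSphere_real_apply_univ]
    refine mul_pos (by simpa using by linarith) ?_
    exact ENNReal.toReal_pos (Metric.measure_ball_pos _ _ one_pos).ne' measure_ball_lt_top.ne
  exact mul_pos (mul_pos (by linarith) (Real.rpow_pos_of_pos hC₀ _)) hS

lemma IsL2InTime.posPart {v : ℝ → L2 Ω} (hv : IsL2InTime T v) :
    IsL2InTime T (fun t => (v t)⁺) :=
  lipschitzWith_posPart.comp_memLp (by simp) hv

/-! ### The comparison principle -/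

/-- Testing the first equation with `u⁺` and the second with `v⁺`, and using
`(u - v, u⁺) ≥ ‖u⁺‖² - (u⁺, v⁺)` and `(u, v⁺) ≤ (u⁺, v⁺)`, gives
`∫ ‖∇u⁺‖² + κ ∫ ‖u⁺ - v⁺‖² ≤ 0`, where `κ = (n - 2) C₀^(n-2) ω_n`. -/
lemma IsWeakSolutionTransformed.nonpos (hn : 3 ≤ n) (hΩ : Bornology.IsBounded Ω) (hT : 0 < T)
    (hα : 0 ≤ α) (hβ : 0 ≤ β) (hlam : 0 ≤ lam) (hC₀ : 0 < C₀) {f g : ℝ → L2 Ω}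
    {u : ℝ → H10 Ω} {v : ℝ → L2 Ω}
    (hf : ∀ᵐ t ∂timeMeasure T, f t ≤ 0) (hg : ∀ᵐ t ∂timeMeasure T, g t ≤ 0)
    (h : IsWeakSolutionTransformed Ω T α β lam C₀ f g u v) :
    ∀ᵐ t ∂timeMeasure T, toL2 (u t) ≤ 0 ∧ v t ≤ 0 := by
  obtain ⟨⟨hu, hu0, w, hw, hwD, hueq⟩, hv, hv0, z, hz, hzD, hveq⟩ := h
  obtain ⟨P, hP, hPu, hPgrad⟩ := exists_lift_posPart hΩ hu
  have hκ := strangeCoeff_pos hn hC₀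
  set κ := strangeCoeff n C₀
  have hc : 0 < ((n : ℝ) - 2) / C₀ := by
    have h3 : (3 : ℝ) ≤ n := by exact_mod_cast hn
    exact div_pos (by linarith) hC₀
  set c := ((n : ℝ) - 2) / C₀
  have hU := hu.toL2.posPart
  have hZ := hv.posPart
  set μ := timeMeasure T
  have hP : IsL2InTime T P := hP
  -- the time derivatives contribute nonnegative terms
  have hwP : 0 ≤ ∫ t, w t (P t) ∂μ := by
    refine integral_apply_posPart_nonneg toL2 hα hu.toL2 hP hw hPu ?_
    exact hwD.ae_eq_primitive hT (hu.toL2.const_smul α).toHneg1.integrable hw.integrable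
      hu0.toHneg1
  have hzZ : 0 ≤ ∫ t, inner ℝ (z t) (v t)⁺ ∂μ := by
    have hD : ∀ᵐ t ∂μ, β • v t = ∫ s in (0 : ℝ)..t, z s :=
      hzD.ae_eq_primitive hT
        (hv.const_smul β).integrable hz.integrable hv0
    refine integral_apply_posPart_nonneg (ContinuousLinearMap.id ℝ (L2 Ω)) hβ hv hZ
      (w := fun t => innerSL ℝ (z t)) ((innerSL ℝ).comp_memLp' hz)
      (ae_of_all _ fun t => rfl) ?_
    filter_upwards [hD, ae_restrict_mem measurableSet_Ioo] with t ht htT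
    rw [ContinuousLinearMap.comp_id, ht]
    refine (ContinuousLinearMap.intervalIntegral_comp_comm (innerSL ℝ) ?_).symm
    rw [intervalIntegrable_iff_integrableOn_Ioo_of_le htT.1.le]
    exact IntegrableOn.mono_set hz.integrable (Ioo_subset_Ioo_right htT.2.le)
  have iUU : Integrable (fun t => ‖(toL2 (u t))⁺‖ ^ 2) μ := MemLp.integrable_norm_pow hU (by simp)
  have iZZ : Integrable (fun t => ‖(v t)⁺‖ ^ 2) μ := MemLp.integrable_norm_pow hZ (by simp)
  have iUZ : Integrable (fun t => (inner ℝ (toL2 (u t))⁺ (v t)⁺ : ℝ)) μ :=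
    integrable_inner_of_memLp hU hZ
  have iG : Integrable (fun t => ‖grad (P t)‖ ^ 2) μ :=
    MemLp.integrable_norm_pow hP.grad (by simp)
  -- the first equation
  have h1 : ∫ t, ‖grad (P t)‖ ^ 2 ∂μ +
      κ * ∫ t, (‖(toL2 (u t))⁺‖ ^ 2 - inner ℝ (toL2 (u t))⁺ (v t)⁺) ∂μ ≤ 0 := by
    have e := hueq P hP
    have e1 : ∫ t, inner ℝ (f t) (toL2 (P t)) ∂μ ≤ 0 := by
      refine integral_nonpos_of_ae ?_
      filter_upwards [hf, hPu] with t a b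
      rw [b]
      exact inner_nonpos_of_nonpos_of_nonneg a (posPart_nonneg _)
    have e2 : ∫ t, (‖(toL2 (u t))⁺‖ ^ 2 - inner ℝ (toL2 (u t))⁺ (v t)⁺) ∂μ ≤
        ∫ t, inner ℝ (toL2 (u t) - v t) (toL2 (P t)) ∂μ := by
      refine integral_mono_ae (iUU.sub iUZ)
        (integrable_inner_of_memLp (hu.toL2.sub hv) hP.toL2) ?_
      filter_upwards [hPu] with t a
      rw [a, inner_sub_left, inner_self_posPart, real_inner_comm (v t)⁺]
      linarith [inner_le_inner_posPart (v t) (posPart_nonneg (toL2 (u t)))]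
    nlinarith [mul_le_mul_of_nonneg_left e2 hκ.le]
  -- the second equation
  have h2 : ∫ t, (‖(v t)⁺‖ ^ 2 - inner ℝ (toL2 (u t))⁺ (v t)⁺) ∂μ ≤ 0 := by
    have e1 : ∫ t, inner ℝ (z t) (v t)⁺ ∂μ ≤
        ∫ t, -c * (‖(v t)⁺‖ ^ 2 - inner ℝ (toL2 (u t))⁺ (v t)⁺) ∂μ := by
      refine integral_mono_ae (integrable_inner_of_memLp hz hZ)
        ((iZZ.sub iUZ).const_mul (-c)) ?_
      filter_upwards [hveq, hg] with t a b
      have e := congrArg (fun x => (inner ℝ x (v t)⁺ : ℝ)) a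
      simp only [inner_add_left, real_inner_smul_left, inner_self_posPart] at e
      have e3 := inner_le_inner_posPart (toL2 (u t)) (posPart_nonneg (v t))
      have e4 := inner_nonpos_of_nonpos_of_nonneg b (posPart_nonneg (v t))
      nlinarith [mul_le_mul_of_nonneg_left e3 hc.le, mul_nonneg hlam (sq_nonneg ‖(v t)⁺‖)]
    rw [integral_const_mul] at e1
    by_contra! h3
    nlinarith
  have hsum : ∫ t, (‖grad (P t)‖ ^ 2 + κ * ‖(toL2 (u t))⁺ - (v t)⁺‖ ^ 2) ∂μ ≤ 0 := by
    have e : ∀ t, ‖grad (P t)‖ ^ 2 + κ * ‖(toL2 (u t))⁺ - (v t)⁺‖ ^ 2 = ‖grad (P t)‖ ^ 2 +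
        (κ * (‖(toL2 (u t))⁺‖ ^ 2 - inner ℝ (toL2 (u t))⁺ (v t)⁺) +
        κ * (‖(v t)⁺‖ ^ 2 - inner ℝ (toL2 (u t))⁺ (v t)⁺)) := by
      intro t
      rw [norm_sub_sq_real]
      ring
    simp_rw [e]
    have i1 := (iUU.sub iUZ).const_mul κ
    have i2 := (iZZ.sub iUZ).const_mul κ
    simp only [Pi.sub_apply] at i1 i2
    rw [integral_add iG (show Integrable (fun t => _ + _) μ from i1.add i2),
      integral_add i1 i2, integral_const_mul, integral_const_mul]
    nlinarith [mul_le_mul_of_nonneg_left h2 hκ.le]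
  have hnonneg : ∀ t, 0 ≤ ‖grad (P t)‖ ^ 2 + κ * ‖(toL2 (u t))⁺ - (v t)⁺‖ ^ 2 := fun t => by
    positivity
  have hzero := (integral_eq_zero_iff_of_nonneg hnonneg
    (iG.add ((MemLp.integrable_norm_pow (hU.sub hZ) (by simp)).const_mul κ))).1
    (le_antisymm hsum (integral_nonneg hnonneg))
  obtain ⟨C, -, hC⟩ := exists_norm_toL2_le (Ω := Ω) hn hΩ
  filter_upwards [hzero, hPu] with t a b
  simp only [Pi.zero_apply] at a
  have a1 : ‖grad (P t)‖ ^ 2 = 0 := by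
    nlinarith [sq_nonneg ‖grad (P t)‖, mul_nonneg hκ.le (sq_nonneg ‖(toL2 (u t))⁺ - (v t)⁺‖)]
  have a2 : ‖(toL2 (u t))⁺ - (v t)⁺‖ ^ 2 = 0 := by
    rw [a1, zero_add] at a
    exact (mul_eq_zero.1 a).resolve_left hκ.ne'
  have b1 : (toL2 (u t))⁺ = 0 := by
    rw [← b, ← norm_le_zero_iff]
    simpa [pow_eq_zero_iff two_ne_zero |>.1 a1] using hC (P t)
  have b2 : (v t)⁺ = 0 := by
    have := norm_eq_zero.1 (pow_eq_zero_iff two_ne_zero |>.1 a2)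
    rw [b1, zero_sub, neg_eq_zero] at this
    exact this
  exact ⟨posPart_eq_zero.1 b1, posPart_eq_zero.1 b2⟩

/-! ### Linearity -/

lemma IsWeakParabolicSolution.sub {f₁ f₂ H₁ H₂ : ℝ → L2 Ω} {u₁ u₂ : ℝ → H10 Ω}
    (hf₁ : IsL2InTime T f₁) (hf₂ : IsL2InTime T f₂)
    (hH₁ : IsL2InTime T H₁) (hH₂ : IsL2InTime T H₂)
    (h₁ : IsWeakParabolicSolution Ω T α C₀ f₁ u₁ H₁)
    (h₂ : IsWeakParabolicSolution Ω T α C₀ f₂ u₂ H₂) :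
    IsWeakParabolicSolution Ω T α C₀ (fun t => f₁ t - f₂ t) (fun t => u₁ t - u₂ t)
      (fun t => H₁ t - H₂ t) := by
  obtain ⟨hu₁, hi₁, w₁, hw₁, hd₁, he₁⟩ := h₁
  obtain ⟨hu₂, hi₂, w₂, hw₂, hd₂, he₂⟩ := h₂
  refine ⟨hu₁.sub hu₂, ?_, fun t => w₁ t - w₂ t, hw₁.sub hw₂, ?_, fun φ hφ => ?_⟩
  · simpa [smul_sub] using hi₁.sub hi₂
  · have := hd₁.sub (hu₁.toL2.const_smul α).toHneg1.integrable
      (hu₂.toL2.const_smul α).toHneg1.integrable hw₁.integrable hw₂.integrable hd₂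
    simpa only [← toHneg1_sub, ← smul_sub, ← map_sub] using this
  · have e₁ := he₁ φ hφ
    have e₂ := he₂ φ hφ
    have i : ∀ {w : ℝ → Hneg1 Ω}, IsL2InTime T w →
        Integrable (fun t => w t (φ t)) (timeMeasure T) := fun hw =>
      hw.integrable_apply hφ
    have j : ∀ {y : ℝ → L2 Ω}, IsL2InTime T y →
        Integrable (fun t => (inner ℝ (y t) (toL2 (φ t)) : ℝ)) (timeMeasure T) := fun hy =>
      integrable_inner_of_memLp hy hφ.toL2
    have k : ∀ {u : ℝ → H10 Ω}, IsL2InTime T u →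
        Integrable (fun t => (inner ℝ (grad (u t)) (grad (φ t)) : ℝ)) (timeMeasure T) := fun hu =>
      integrable_inner_of_memLp hu.grad hφ.grad
    simp only [sub_apply, map_sub, inner_sub_left]
    rw [integral_sub (i hw₁) (i hw₂), integral_sub (k hu₁) (k hu₂), integral_sub (j hH₁) (j hH₂),
      integral_sub (j hf₁) (j hf₂)]
    linear_combination e₁ - e₂

lemma IsWeakSolutionTransformed.sub {f₁ f₂ g₁ g₂ v₁ v₂ : ℝ → L2 Ω} {u₁ u₂ : ℝ → H10 Ω}
    (hf₁ : IsL2InTime T f₁) (hf₂ : IsL2InTime T f₂)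
    (h₁ : IsWeakSolutionTransformed Ω T α β lam C₀ f₁ g₁ u₁ v₁)
    (h₂ : IsWeakSolutionTransformed Ω T α β lam C₀ f₂ g₂ u₂ v₂) :
    IsWeakSolutionTransformed Ω T α β lam C₀ (fun t => f₁ t - f₂ t) (fun t => g₁ t - g₂ t)
      (fun t => u₁ t - u₂ t) (fun t => v₁ t - v₂ t) := by
  obtain ⟨hp₁, hv₁, hi₁, z₁, hz₁, hd₁, he₁⟩ := h₁
  obtain ⟨hp₂, hv₂, hi₂, z₂, hz₂, hd₂, he₂⟩ := h₂
  have hint : ∀ {v : ℝ → L2 Ω}, IsL2InTime T v →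
      Integrable (fun t => β • v t) (timeMeasure T) := fun hv => hv.integrable.smul β
  refine ⟨?_, hv₁.sub hv₂, ?_, fun t => z₁ t - z₂ t, hz₁.sub hz₂, ?_, ?_⟩
  · have j : ∀ {u : ℝ → H10 Ω} {v : ℝ → L2 Ω}, IsL2InTime T u → IsL2InTime T v →
        IsL2InTime T (fun t => toL2 (u t) - v t) := fun hu hv => hu.toL2.sub hv
    have := hp₁.sub hf₁ hf₂ (j hp₁.mem_u hv₁) (j hp₂.mem_u hv₂) hp₂
    convert this using 2 with t
    rw [map_sub]
    abel
  · simpa [smul_sub] using hi₁.sub hi₂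
  · simpa only [smul_sub] using hd₁.sub (hint hv₁) (hint hv₂) hz₁.integrable hz₂.integrable hd₂
  · filter_upwards [he₁, he₂] with t a b
    have a' := eq_sub_of_add_eq a
    have b' := eq_sub_of_add_eq b
    rw [a', b', map_sub, smul_sub, smul_sub]
    abel

lemma IsWeakSolution.sub {f₁ f₂ g₁ g₂ H₁ H₂ : ℝ → L2 Ω} {u₁ u₂ : ℝ → H10 Ω}
    (hf₁ : IsL2InTime T f₁) (hf₂ : IsL2InTime T f₂)
    (h₁ : IsWeakSolution Ω T α β lam C₀ f₁ g₁ u₁ H₁)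
    (h₂ : IsWeakSolution Ω T α β lam C₀ f₂ g₂ u₂ H₂) :
    IsWeakSolution Ω T α β lam C₀ (fun t => f₁ t - f₂ t) (fun t => g₁ t - g₂ t)
      (fun t => u₁ t - u₂ t) (fun t => H₁ t - H₂ t) := by
  obtain ⟨hp₁, hH₁, hi₁, z₁, hz₁, hd₁, he₁⟩ := h₁
  obtain ⟨hp₂, hH₂, hi₂, z₂, hz₂, hd₂, he₂⟩ := h₂
  have hint : ∀ {u : ℝ → H10 Ω} {H : ℝ → L2 Ω}, IsL2InTime T u → IsL2InTime T H →
      Integrable (fun t => β • (H t - toL2 (u t))) (timeMeasure T) := fun hu hH =>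
    (hH.integrable.sub hu.toL2.integrable).smul β
  refine ⟨hp₁.sub hf₁ hf₂ hH₁ hH₂ hp₂, hH₁.sub hH₂, ?_, fun t => z₁ t - z₂ t,
    hz₁.sub hz₂, ?_, ?_⟩
  · simpa [smul_sub] using hi₁.sub hi₂
  · have := hd₁.sub (hint hp₁.mem_u hH₁) (hint hp₂.mem_u hH₂) hz₁.integrable hz₂.integrable hd₂
    convert this using 2 with t
    rw [map_sub, ← smul_sub]
    congr 1
    abel
  · filter_upwards [he₁, he₂] with t a b
    have a' := eq_sub_of_add_eq a
    have b' := eq_sub_of_add_eq b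
    rw [a', b', map_sub]
    module

/-! ### Uniqueness -/

/-- If `α u = 0`, then the equation with `f = 0` holds at almost every time; its energy identity
is obtained with the test functions `1_A u`, where `A` is a measurable set of times. -/
lemma IsWeakParabolicSolution.ae_energy_eq_zero {u : ℝ → H10 Ω} {H : ℝ → L2 Ω}
    (hH : IsL2InTime T H)
    (h : IsWeakParabolicSolution Ω T α C₀ (fun _ => 0) u H)
    (h0 : ∀ᵐ t ∂timeMeasure T, α • toL2 (u t) = 0) :
    ∀ᵐ t ∂timeMeasure T, ‖grad (u t)‖ ^ 2 + strangeCoeff n C₀ * inner ℝ (H t) (toL2 (u t)) = 0 := by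
  obtain ⟨hu, -, w, hw, hd, he⟩ := h
  have hw0 : ∀ᵐ t ∂timeMeasure T, w t = 0 := by
    refine hd.ae_eq_zero hw.integrable (h0.mono fun t ht => ?_)
    rw [ht, toHneg1_zero]
  have i1 : Integrable (fun t => ‖grad (u t)‖ ^ 2) (timeMeasure T) :=
    MemLp.integrable_norm_pow hu.grad (by simp)
  have i2 : Integrable (fun t => (inner ℝ (H t) (toL2 (u t)) : ℝ)) (timeMeasure T) :=
    integrable_inner_of_memLp hH hu.toL2
  refine Integrable.ae_eq_zero_of_forall_setIntegral_eq_zero (i1.add (i2.const_mul _))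
    fun A hA _ => ?_
  have e := he (A.indicator u) (MemLp.indicator hA hu)
  have e1 : ∫ t, w t (A.indicator u t) ∂timeMeasure T = 0 :=
    integral_eq_zero_of_ae (hw0.mono fun t ht => by simp [ht])
  have e2 : ∀ t, inner ℝ (grad (u t)) (grad (A.indicator u t)) =
      A.indicator (fun t => ‖grad (u t)‖ ^ 2) t := by
    intro t
    by_cases ht : t ∈ A <;> simp [ht]
  have e3 : ∀ t, inner ℝ (H t) (toL2 (A.indicator u t)) =
      A.indicator (fun t => (inner ℝ (H t) (toL2 (u t)) : ℝ)) t := by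
    intro t
    by_cases ht : t ∈ A <;> simp [ht]
  simp only [e1, e2, e3, inner_zero_left, integral_zero, zero_add] at e
  rw [integral_indicator hA, integral_indicator hA] at e
  rw [← e, ← integral_const_mul]
  exact integral_add i1.integrableOn (i2.const_mul _).integrableOn

lemma IsWeakSolutionTransformed.ae_eq_zero (hn : 3 ≤ n) (hΩ : Bornology.IsBounded Ω)
    (hT : 0 < T) (hα : 0 ≤ α) (hβ : 0 ≤ β) (hlam : 0 ≤ lam) (hC₀ : 0 < C₀)
    {u : ℝ → H10 Ω} {v : ℝ → L2 Ω}
    (h : IsWeakSolutionTransformed Ω T α β lam C₀ (fun _ => 0) (fun _ => 0) u v) :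
    ∀ᵐ t ∂timeMeasure T, u t = 0 ∧ v t = 0 := by
  have hz : IsL2InTime T (fun _ : ℝ => (0 : L2 Ω)) := MemLp.zero
  have hneg : IsWeakSolutionTransformed Ω T α β lam C₀ (fun _ => 0) (fun _ => 0)
      (fun t => -u t) (fun t => -v t) := by
    -- `-u = (u - u) - u`
    have h1 := h.sub hz hz h
    simp only [sub_self] at h1
    simpa only [sub_self, zero_sub, neg_zero] using h1.sub hz hz h
  have h1 := h.nonpos hn hΩ hT hα hβ hlam hC₀ (by simp) (by simp)
  have h2 := hneg.nonpos hn hΩ hT hα hβ hlam hC₀ (by simp) (by simp)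
  have h3 : ∀ᵐ t ∂timeMeasure T, toL2 (u t) = 0 ∧ v t = 0 := by
    filter_upwards [h1, h2] with t a b
    rw [map_neg, neg_nonpos, neg_nonpos] at b
    exact ⟨le_antisymm a.1 b.1, le_antisymm a.2 b.2⟩
  have h4 := h.parabolic.ae_energy_eq_zero (h.parabolic.mem_u.toL2.sub h.mem_v)
    (h3.mono fun t ht => by rw [ht.1, smul_zero])
  filter_upwards [h3, h4] with t a b
  refine ⟨?_, a.2⟩
  rw [a.1, inner_zero_right, mul_zero, add_zero] at b
  have : ‖u t‖ ^ 2 = 0 := by rw [norm_sq_eq, a.1, b]; simp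
  exact norm_eq_zero.1 (pow_eq_zero_iff two_ne_zero |>.1 this)

/-- For solutions of the limit system with vanishing data, `β (u - H)` vanishes initially. For
`α > 0` this is immediate. For `α = 0` the first equation is elliptic at almost every time and gives
`‖u(t)‖ ≤ K ‖H(t)‖`; since `β (u - H)` and `β H` are continuous in time, so is `β u`, and it
vanishes at `t = 0` together with `β H`. -/
lemma IsWeakSolution.hasInitialValue_sub (hn : 3 ≤ n) (hΩ : Bornology.IsBounded Ω)
    (hT : 0 < T) (hα : 0 ≤ α) (hC₀ : 0 < C₀) {g : ℝ → L2 Ω} {u : ℝ → H10 Ω} {H : ℝ → L2 Ω}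
    (h : IsWeakSolution Ω T α β lam C₀ (fun _ => 0) g u H) :
    HasInitialValue T (fun t => β • (toL2 (u t) - H t)) 0 := by
  obtain ⟨hp, hH, hi, z, hz, hd, -⟩ := h
  rcases hα.lt_or_eq with hα | rfl
  · have h1 := (hp.initial.map ((β / α) • ContinuousLinearMap.id ℝ (L2 Ω))).sub hi
    have e : ∀ t, ((β / α) • ContinuousLinearMap.id ℝ (L2 Ω)) (α • toL2 (u t)) - β • H t =
        β • (toL2 (u t) - H t) := fun t => by
      rw [smul_apply, ContinuousLinearMap.id_apply, smul_smul,
        div_mul_cancel₀ _ hα.ne', smul_sub]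
    simpa only [e, map_zero, sub_zero] using h1
  · have hu := hp.mem_u
    obtain ⟨C, hC0, hC⟩ := exists_norm_toL2_le (Ω := Ω) hn hΩ
    have hκ := strangeCoeff_pos hn hC₀
    set κ := strangeCoeff n C₀ with hκdef
    have hbound : ∀ᵐ t ∂timeMeasure T, ‖toL2 (u t)‖ ≤ C ^ 2 * κ * ‖H t‖ := by
      filter_upwards [hp.ae_energy_eq_zero hH (ae_of_all _ fun t => zero_smul ℝ _)] with t ht
      rw [← hκdef] at ht
      have e1 := hC (u t)
      have e2 := (abs_le.1 (abs_real_inner_le_norm (H t) (toL2 (u t)))).1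
      have e3 : ‖grad (u t)‖ ^ 2 ≤ κ * (‖H t‖ * ‖toL2 (u t)‖) := by nlinarith
      have e4 : ‖toL2 (u t)‖ ^ 2 ≤ C ^ 2 * (κ * (‖H t‖ * ‖toL2 (u t)‖)) := by
        calc ‖toL2 (u t)‖ ^ 2 ≤ (C * ‖grad (u t)‖) ^ 2 := by gcongr
          _ = C ^ 2 * ‖grad (u t)‖ ^ 2 := by ring
          _ ≤ _ := by gcongr
      rcases (norm_nonneg (toL2 (u t))).eq_or_lt with h0 | h0
      · rw [← h0]; positivity
      · refine le_of_mul_le_mul_right ?_ h0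
        nlinarith
    have hint : Integrable (fun t => β • (H t - toL2 (u t))) (timeMeasure T) :=
      (hH.integrable.sub hu.toL2.integrable).smul β
    obtain ⟨c, hc⟩ := hd.exists_ae_eq_primitive hT hint hz.integrable
    obtain ⟨y, hy, hHy, hy0⟩ := hi
    set Y : ℝ → L2 Ω := fun t => c + ∫ s in (0 : ℝ)..t, z s
    have hY : ContinuousOn Y (Icc 0 T) :=
      continuousOn_const.add (continuousOn_primitive_timeMeasure hT hz.integrable)
    -- the bound passes from almost all times to the continuous representatives
    have hle := eqOn_Icc_of_ae_timeMeasure hT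
      (y := fun t => max (‖y t - Y t‖ - C ^ 2 * κ * ‖y t‖) 0) (z := fun _ => 0)
      ((((hy.sub hY).norm).sub (continuousOn_const.mul hy.norm)).sup continuousOn_const)
      continuousOn_const (by
        filter_upwards [hbound, hc, hHy] with t a b d
        rw [max_eq_right_iff, sub_nonpos]
        simp only [Y]
        rw [← b, ← d, ← smul_sub, sub_sub_cancel, norm_smul, norm_smul]
        calc ‖β‖ * ‖toL2 (u t)‖ ≤ ‖β‖ * (C ^ 2 * κ * ‖H t‖) := by gcongr
          _ = _ := by ring) (left_mem_Icc.2 hT.le)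
    have hc0 : c = 0 := by
      simpa [hy0, Y] using hle
    refine ⟨fun t => -Y t, hY.neg, ?_, by simp [Y, hc0]⟩
    filter_upwards [hc] with t ht
    simp only [Y]
    rw [← ht, ← smul_neg, neg_sub]

/-- The change of variable `v = u - H`, for vanishing data. -/
lemma IsWeakSolution.transformed (hn : 3 ≤ n) (hΩ : Bornology.IsBounded Ω)
    (hT : 0 < T) (hα : 0 ≤ α) (hC₀ : 0 < C₀) {u : ℝ → H10 Ω} {H : ℝ → L2 Ω}
    (h : IsWeakSolution Ω T α β lam C₀ (fun _ => 0) (fun _ => 0) u H) :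
    IsWeakSolutionTransformed Ω T α β lam C₀ (fun _ => 0) (fun _ => 0) u
      (fun t => toL2 (u t) - H t) := by
  have h0 := h.hasInitialValue_sub hn hΩ hT hα hC₀
  obtain ⟨hp, hH, hi, z, hz, hd, he⟩ := h
  refine ⟨by simpa using hp, hp.mem_u.toL2.sub hH, h0, fun t => -z t, MemLp.neg hz, ?_, ?_⟩
  · simpa only [← smul_neg, neg_sub] using hd.neg
  · filter_upwards [he] with t ht
    rw [eq_sub_of_add_eq ht]
    module

end Main

end LimitSystem

end

theorem mainTheorem2 (n : ℕ) (hn : 3 ≤ n) (Ω : Set (EuclideanSpace ℝ (Fin n)))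
    (hΩ_open : IsOpen Ω) (hΩ_bdd : Bornology.IsBounded Ω)
    (T α β lam C₀ : ℝ) (hT : 0 < T) (hα : 0 ≤ α) (hβ : 0 ≤ β) (hαβ : 0 < α ∨ 0 < β)
    (hlam : 0 ≤ lam) (hC₀ : 0 < C₀) :
    -- comparison principle
    (∀ (f g : ℝ → LimitSystem.L2 Ω) (u : ℝ → LimitSystem.H10 Ω) (v : ℝ → LimitSystem.L2 Ω),
      LimitSystem.IsL2InTime T f → LimitSystem.IsL2InTime T g →
      (∀ᵐ t ∂LimitSystem.timeMeasure T, f t ≤ 0) →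
      (∀ᵐ t ∂LimitSystem.timeMeasure T, g t ≤ 0) →
      LimitSystem.IsWeakSolutionTransformed Ω T α β lam C₀ f g u v →
      ∀ᵐ t ∂LimitSystem.timeMeasure T, LimitSystem.toL2 (u t) ≤ 0 ∧ v t ≤ 0) ∧
    -- uniqueness for the transformed system
    (∀ (f g : ℝ → LimitSystem.L2 Ω) (u₁ u₂ : ℝ → LimitSystem.H10 Ω)
      (v₁ v₂ : ℝ → LimitSystem.L2 Ω),
      LimitSystem.IsL2InTime T f → LimitSystem.IsL2InTime T g →
      LimitSystem.IsWeakSolutionTransformed Ω T α β lam C₀ f g u₁ v₁ →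
      LimitSystem.IsWeakSolutionTransformed Ω T α β lam C₀ f g u₂ v₂ →
      ∀ᵐ t ∂LimitSystem.timeMeasure T, u₁ t = u₂ t ∧ v₁ t = v₂ t) ∧
    -- uniqueness for the original limit system
    (∀ (f g : ℝ → LimitSystem.L2 Ω) (u₁ u₂ : ℝ → LimitSystem.H10 Ω)
      (H₁ H₂ : ℝ → LimitSystem.L2 Ω),
      LimitSystem.IsL2InTime T f → LimitSystem.IsL2InTime T g →
      LimitSystem.IsWeakSolution Ω T α β lam C₀ f g u₁ H₁ →
      LimitSystem.IsWeakSolution Ω T α β lam C₀ f g u₂ H₂ →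
      ∀ᵐ t ∂LimitSystem.timeMeasure T, u₁ t = u₂ t ∧ H₁ t = H₂ t) := by
  refine ⟨fun f g u v _ _ hf0 hg0 h => h.nonpos hn hΩ_bdd hT hα hβ hlam hC₀ hf0 hg0,
    fun f g u₁ u₂ v₁ v₂ hf hg h₁ h₂ => ?_, fun f g u₁ u₂ H₁ H₂ hf hg h₁ h₂ => ?_⟩
  · have h := h₁.sub hf hf h₂
    simp only [sub_self] at h
    filter_upwards [h.ae_eq_zero hn hΩ_bdd hT hα hβ hlam hC₀] with t ht
    exact ⟨sub_eq_zero.1 ht.1, sub_eq_zero.1 ht.2⟩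
  · have h := h₁.sub hf hf h₂
    simp only [sub_self] at h
    filter_upwards [(h.transformed hn hΩ_bdd hT hα hC₀).ae_eq_zero hn hΩ_bdd hT hα hβ hlam hC₀]
      with t ht
    have hu := sub_eq_zero.1 ht.1
    rw [hu, sub_self, map_zero, zero_sub, neg_eq_zero] at ht
    exact ⟨hu, sub_eq_zero.1 ht.2⟩
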